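/- Setting. There are $M\ge 1$ tasks and $N\ge 2$ workers. At each time $t=0,1,2,\dots$, assigning task $j$ to worker $i$ yields a value $X^t_{(i,j)}$ with an unknown law on $[0,1]$ that depends only on $(i,j)$ and has mean $\mu_{(i,j)}$; all values are independent over $t,i,j$. Known undirected graphs $G_w$ on the workers and $G_o$ on the tasks are given; let $G=G_w\,\square\,G_o$ be their Cartesian product, on the set of actions $(i,j)$. A dominating set of $G$ is fixed in advance; each action $a$ is assigned an element $\mathrm{dom}(a)$ of that set that is equal or adjacent to $a$. Performing an action $d$ (one test, of unit cost) at time $t$ reveals the values $X^t_b$ for all actions $b$ dominated by $d$: all of these are equal or adjacent to $d$, and they include every $a$ with $\mathrm{dom}(a)=d$. Gaps. For $i$ best for task $j$ put $\Delta_{(i,j)}=\mu_{(i,j)}-\max_{i'\ne i}\mu_{(i',j)}$, and otherwise $\Delta_{(i,j)}=\max_{i'}\mu_{(i',j)}-\mu_{(i,j)}$. Let $$H=\sum_{j=1}^{M}\sum_{i=1}^{N}\frac{1}{\max(\Delta_{(i,j)},\varepsilon/2)^2}.$$ A team $S$ of workers is $\varepsilon$-optimal if $\max_{i}\mu_{(i,j)}-\max_{i\in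 S}\mu_{(i,j)}\le\varepsilon$ for every task $j$. Algorithm AExpSelect, with parameters $\varepsilon>0$ and $0<\delta<1$. Let $y^t_a$ be the number of observations of action $a$ before time $t$ and $\mu^t_a$ their average ($0$ if there are none), and let $$\beta(y,t)=\sqrt{\tfrac1{2y}\ln\!\left(\tfrac54\cdot\tfrac{MN}{\delta}\,t^4\right)},\qquad \beta(0,t)=\infty .$$ For a task $j$, let $h$ be a worker maximizing $\mu^t_{(h,j)}$, let $\ell\neq h$ be a worker maximizing $\mu^t_{(\ell,j)}+\beta(y^t_{(\ell,j)},t)$ among the workers other than $h$, and put $$\Delta^t_j=\bigl(\mu^t_{(\ell,j)}+\beta(y^t_{(\ell,j)},t)\bigr)-\bigl(\mu^t_{(h,j)}-\beta(y^t_{(h,j)},t)\bigr).$$ Start at $t=0$ with the team $S=\emptyset$ and all tasks open. While some task is open: choose an open task $q$ with the largest $\Delta^t_q$; let $p$ be the one of its workers $h,\ell$ with the larger radius $\beta(y^t_{(\cdot,q)},t)$; perform the action $\mathrm{dom}(p,q)$, update the counts and averages of all observed actions, and increase $t$ by one; then, for each open task $j$ with $\Delta^t_j\le\varepsilon$, add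 its worker $h$ to $S$ and close the task. When no task is open, output $S$. Ties are broken by any fixed rule (possibly depending on the time and the task). Theorem. AExpSelect is $(\varepsilon,\delta)$-PAC: with probability at least $1-\delta$ it terminates and outputs an $\varepsilon$-optimal team of at most $M$ workers. Moreover, there is an absolute constant $C>0$ such that, whenever $\varepsilon\le 2$, the expected number of tests that it performs is at most $C\,H\ln(H/\delta)$. -/

import Mathlib

open MeasureTheory ProbabilityTheory
open scoped ENNReal

noncomputable section

namespace TeamHiring

/-! ### Problem parameters

Workers are indexed by `Fin N`, tasks by `Fin M`; an action is a pair (worker, task).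
`μ i j` is the mean performance of worker `i` on task `j`. -/

/-- The gap `Δ_(i,j)`: for a best worker of task `j`, the distance to the best of the other workers;
for any other worker, the distance to the best worker. (If several workers are best for task `j`,
all of them have gap `0`, whichever of them is designated as the best one.) -/
def gap {M N : ℕ} (μ : Fin N → Fin M → ℝ) (i : Fin N) (j : Fin M) : ℝ :=
  open Classical in
  if ∀ i', μ i' j ≤ μ i j then μ i j - ⨆ i' : {i' : Fin N // i' ≠ i}, μ i' j
  else (⨆ i', μ i' j) - μ i j

/-- The hardness `H = ∑ⱼ ∑ᵢ 1 / max(Δ_(i,j), ε/2)²`. -/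
def hardness {M N : ℕ} (μ : Fin N → Fin M → ℝ) (ε : ℝ) : ℝ :=
  ∑ j, ∑ i, 1 / (max (gap μ i j) (ε / 2)) ^ 2

/-- A team `S` is `ε`-optimal if, for each task, the best performance within `S` is within `ε` of
the best performance among all workers. -/
def IsEpsOptimalTeam {M N : ℕ} (μ : Fin N → Fin M → ℝ) (ε : ℝ) (S : Finset (Fin N)) : Prop :=
  ∀ j, ∃ i ∈ S, (⨆ i', μ i' j) - μ i j ≤ ε

/-! ### Side observations -/

/-- A dominating set of the side-observation graph `G`, with the two maps used by the algorithm: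
`dominator a` is the member of the set that dominates the action `a`, and `dominated d` is the set
of actions that are observed when `d` is performed. The latter contains every action that is
dominated through `d`, and only `d` and its neighbours; it may be the whole closed neighbourhood of
`d`, or only the actions `a` with `dominator a = d`. -/
structure DominatingScheme {V : Type*} (G : SimpleGraph V) where
  set : Finset V
  dominator : V → V
  dominator_mem : ∀ a, dominator a ∈ set
  dominator_eq_or_adj : ∀ a, dominator a = a ∨ G.Adj a (dominator a)
  dominated : V → Finset V
  mem_dominated : ∀ a, a ∈ dominated (dominator a)
  eq_or_adj_of_mem : ∀ d, ∀ b ∈ dominated d, b = d ∨ G.Adj d b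

/-! ### Arg max with ties -/

/-- The set of maximizers of `f` over `s`. -/
def maximizers {ι : Type*} (s : Finset ι) (f : ι → EReal) : Finset ι :=
  open Classical in s.filter fun i => ∀ i' ∈ s, f i' ≤ f i

/-- A rule that picks an element of every nonempty finite set (of tied maximizers); the pick may
depend on a parameter in `κ`. -/
structure Selector (κ ι : Type*) where
  pick : κ → Finset ι → ι
  pick_mem : ∀ k s, s.Nonempty → pick k s ∈ s

/-- Tie-breaking rules for the four `arg max` operations of the algorithm. They may depend on the
time, and on the task for the choices among workers. -/
structure TieBreaking (M N : ℕ) where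
  task : Selector ℕ (Fin M)
  best : Selector (ℕ × Fin M) (Fin N)
  challenger : Selector (ℕ × Fin M) (Fin N)
  wider : Selector (ℕ × Fin M) (Fin N)

/-! ### The algorithm -/

/-- The execution variables: the clock `t`, the set `R` of tasks still open, the team `S` built so
far, the number `y a` of observations of each action, and the sum `total a` of these
observations. -/
structure State (M N : ℕ) where
  t : ℕ
  R : Finset (Fin M)
  S : Finset (Fin N)
  y : Fin N × Fin M → ℕ
  total : Fin N × Fin M → ℝ

def State.init (M N : ℕ) : State M N where
  t := 0
  R := Finset.univ
  S := ∅
  y := fun _ => 0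
  total := fun _ => 0

/-- The empirical mean of an action; it is `0` before the first observation. -/
def State.est {M N : ℕ} (s : State M N) (a : Fin N × Fin M) : ℝ := s.total a / s.y a

/-- The confidence radius `β(y,t) = √(1/(2y) · ln(5/4 · MN/δ · t⁴))`, infinite before the first
observation. -/
def beta (M N : ℕ) (δ : ℝ) (y t : ℕ) : EReal :=
  if y = 0 then ⊤
  else (√(1 / (2 * y) * Real.log (5 / 4 * (M * N / δ) * (t : ℝ) ^ 4)) : ℝ)

/-- The confidence radius of an action in the current state. -/
def State.rad {M N : ℕ} (δ : ℝ) (s : State M N) (a : Fin N × Fin M) : EReal :=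
  beta M N δ (s.y a) s.t

/-- The upper confidence bound of an action. -/
def State.ucb {M N : ℕ} (δ : ℝ) (s : State M N) (a : Fin N × Fin M) : EReal :=
  (s.est a : EReal) + s.rad δ a

/-- The lower confidence bound of an action. -/
def State.lcb {M N : ℕ} (δ : ℝ) (s : State M N) (a : Fin N × Fin M) : EReal :=
  (s.est a : EReal) - s.rad δ a

/-- The worker with the highest empirical mean on task `j`. -/
def State.best {M N : ℕ} (tb : TieBreaking M N) (s : State M N) (j : Fin M) : Fin N :=
  tb.best.pick (s.t, j) (maximizers Finset.univ fun i => (s.est (i, j) : EReal))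

/-- Among the other workers, the one with the highest upper confidence bound on task `j`. -/
def State.challenger {M N : ℕ} (tb : TieBreaking M N) (δ : ℝ) (s : State M N) (j : Fin M) :
    Fin N :=
  tb.challenger.pick (s.t, j)
    (maximizers (Finset.univ.erase (s.best tb j)) fun i => s.ucb δ (i, j))

/-- The quantity `Δ_j^t`: the upper confidence bound of the challenger minus the lower confidence
bound of the empirically best worker. -/
def State.uncertainty {M N : ℕ} (tb : TieBreaking M N) (δ : ℝ) (s : State M N) (j : Fin M) :
    EReal :=
  s.ucb δ (s.challenger tb δ j, j) - s.lcb δ (s.best tb j, j)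

/-- The open task with the highest uncertainty. -/
def State.pickedTask {M N : ℕ} (tb : TieBreaking M N) (δ : ℝ) (s : State M N) : Fin M :=
  tb.task.pick s.t (maximizers s.R fun j => s.uncertainty tb δ j)

/-- The greedy action: for the picked task, whichever of the empirically best worker and the
challenger has the larger confidence radius. -/
def State.pickedAction {M N : ℕ} (tb : TieBreaking M N) (δ : ℝ) (s : State M N) :
    Fin N × Fin M :=
  let q := s.pickedTask tb δ
  (tb.wider.pick (s.t, q)
    (maximizers {s.best tb q, s.challenger tb δ q} fun i => s.rad δ (i, q)), q)

/-- Perform an action whose set of observed actions is `obs`, where `x` is the table of performance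
values at the current time: update the counts and the sums, and advance the clock. -/
def State.observe {M N : ℕ} (s : State M N) (obs : Finset (Fin N × Fin M))
    (x : Fin N → Fin M → ℝ) : State M N where
  t := s.t + 1
  R := s.R
  S := s.S
  y := fun a => if a ∈ obs then s.y a + 1 else s.y a
  total := fun a => if a ∈ obs then s.total a + x a.1 a.2 else s.total a

/-- Commit to the empirically best worker for every open task of uncertainty at most `ε`, and close
these tasks. -/
def State.commit {M N : ℕ} (tb : TieBreaking M N) (ε δ : ℝ) (s : State M N) : State M N :=
  open Classical in
  let done := s.R.filter fun j => s.uncertainty tb δ j ≤ (ε : EReal)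
  { s with
    R := s.R \ done
    S := s.S ∪ done.image (s.best tb) }

/-- One iteration of the loop (`x` is the table of performance values at the current time); the
state does not change any more once there is no open task. -/
def State.step {M N : ℕ} {G : SimpleGraph (Fin N × Fin M)} (D : DominatingScheme G)
    (tb : TieBreaking M N) (ε δ : ℝ) (x : Fin N → Fin M → ℝ) (s : State M N) : State M N :=
  if s.R = ∅ then s
  else (s.observe (D.dominated (D.dominator (s.pickedAction tb δ))) x).commit tb ε δ

/-- The state of AExpSelect after `k` iterations (or at termination, if that is earlier), when
`x t i j` is the performance of worker `i` on task `j` at time `t`. -/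
def aexpSelect {M N : ℕ} {G : SimpleGraph (Fin N × Fin M)} (D : DominatingScheme G)
    (tb : TieBreaking M N) (ε δ : ℝ) (x : ℕ → Fin N → Fin M → ℝ) : ℕ → State M N
  | 0 => State.init M N
  | k + 1 => (aexpSelect D tb ε δ x k).step D tb ε δ (x k)

/-- `S` is the output of AExpSelect: the algorithm terminates, and returns the team `S`. -/
def IsOutput {M N : ℕ} {G : SimpleGraph (Fin N × Fin M)} (D : DominatingScheme G)
    (tb : TieBreaking M N) (ε δ : ℝ) (x : ℕ → Fin N → Fin M → ℝ) (S : Finset (Fin N)) : Prop :=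
  ∃ k, (aexpSelect D tb ε δ x k).R = ∅ ∧ (aexpSelect D tb ε δ x k).S = S

/-- The number of tests that AExpSelect performs (one per iteration) until it terminates, `⊤` if it
runs forever. -/
def numTests {M N : ℕ} {G : SimpleGraph (Fin N × Fin M)} (D : DominatingScheme G)
    (tb : TieBreaking M N) (ε δ : ℝ) (x : ℕ → Fin N → Fin M → ℝ) : ℕ∞ :=
  ⨅ k ∈ {k : ℕ | (aexpSelect D tb ε δ x k).R = ∅}, (k : ℕ∞)

end TeamHiring

end

namespace TeamHiring

variable {M N : ℕ}

/-! Three ingredients carry the proof: a counting argument along each run, a time-uniform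
concentration bound, and an expectation bound that does not condition on a good event.

Counting. While a task is open its uncertainty exceeds `ε`. The empirical order of `h` and `ℓ`
bounds this uncertainty by twice the wider radius, so the picked action has radius above `ε/2`
(`State.half_lt_radius`). If moreover all intervals are valid, its gap is at most four times its
radius (`State.gap_le_radius`). Since `2yρ²` equals the logarithmic term, the picked action has been
observed at most `8 log(...) / max(Δ, ε/2)²` times. Performing its dominator observes it once more,
so such picks are few (`card_le_sum_of_y_le`); further side observations only raise counts. The
`ε/2` bound alone forces termination on every sequence of values, because `T ≤ A + K log T` fails
for large `T`.

Concentration. Whether an action is observed at step `k` depends on earlier values only, so `exp (r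
(total - y c) - r² y / 8)` is a supermartingale (`lintegral_exp_run_le_one`). Markov's inequality at
each possible count and a union bound give a one-sided failure probability of order `δ / (MN k³)` at
step `k`. Summed over `k`, this is at most `δ / (MN)` per action and side.

Conclusion. Correctness needs only upper bounds for one best worker per task and lower bounds for
the others, so the failure probabilities total `δ`. For the cost, the number of tests is at most the
number of steps with a failing interval, of expectation at most `2δ`, plus the counting bound;
resolving the logarithm of the run length yields `H log (H/δ)`. -/

lemma mem_maximizers {ι : Type*} {s : Finset ι} {f : ι → EReal} {i : ι} :
    i ∈ maximizers s f ↔ i ∈ s ∧ ∀ i' ∈ s, f i' ≤ f i := by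
  simp [maximizers]

lemma Selector.pick_mem_maximizers {κ ι : Type*} (S : Selector κ ι) (k : κ) {s : Finset ι}
    (hs : s.Nonempty) (f : ι → EReal) :
    S.pick k (maximizers s f) ∈ s ∧ ∀ i' ∈ s, f i' ≤ f (S.pick k (maximizers s f)) := by
  rw [← mem_maximizers]
  apply S.pick_mem
  obtain ⟨i, hi, h⟩ := s.exists_max_image f hs
  exact ⟨i, mem_maximizers.2 ⟨hi, h⟩⟩

/-! ### Confidence radii. -/

/-- The logarithmic factor of the confidence radius. -/
noncomputable def logTerm (M N : ℕ) (δ : ℝ) (t : ℕ) : ℝ :=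
  Real.log (5 / 4 * (M * N / δ) * (t : ℝ) ^ 4)

/-- The confidence radius as a real number (for a positive number of observations). -/
noncomputable def radius (M N : ℕ) (δ : ℝ) (y t : ℕ) : ℝ := √(1 / (2 * y) * logTerm M N δ t)

lemma beta_of_ne_zero (M N : ℕ) (δ : ℝ) {y : ℕ} (hy : y ≠ 0) (t : ℕ) :
    beta M N δ y t = (radius M N δ y t : EReal) := by
  simp [beta, hy, radius, logTerm]

lemma one_le_logTerm_arg (hM : 1 ≤ M) (hN : 2 ≤ N) {δ : ℝ} (hδ : 0 < δ) (hδ' : δ < 1) {t : ℕ}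
    (ht : 1 ≤ t) : 1 ≤ 5 / 4 * (M * N / δ) * (t : ℝ) ^ 4 := by
  have hM' : (1 : ℝ) ≤ M := by exact_mod_cast hM
  have hN' : (2 : ℝ) ≤ N := by exact_mod_cast hN
  have ht' : (1 : ℝ) ≤ (t : ℝ) ^ 4 := one_le_pow₀ (by exact_mod_cast ht)
  have h1 : 1 ≤ (M * N / δ : ℝ) := by
    rw [le_div_iff₀ hδ]; nlinarith
  nlinarith

lemma logTerm_nonneg (hM : 1 ≤ M) (hN : 2 ≤ N) {δ : ℝ} (hδ : 0 < δ) (hδ' : δ < 1) {t : ℕ}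
    (ht : 1 ≤ t) : 0 ≤ logTerm M N δ t :=
  Real.log_nonneg (one_le_logTerm_arg hM hN hδ hδ' ht)

lemma logTerm_mono (hM : 1 ≤ M) (hN : 2 ≤ N) {δ : ℝ} (hδ : 0 < δ) (hδ' : δ < 1) {t t' : ℕ}
    (ht : 1 ≤ t) (htt : t ≤ t') : logTerm M N δ t ≤ logTerm M N δ t' := by
  have h := one_le_logTerm_arg hM hN hδ hδ' ht
  apply Real.log_le_log (by linarith)
  have : (t : ℝ) ≤ t' := by exact_mod_cast htt
  gcongr

lemma logTerm_eq (hM : 1 ≤ M) (hN : 2 ≤ N) {δ : ℝ} (hδ : 0 < δ) {t : ℕ} (ht : 1 ≤ t) :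
    logTerm M N δ t = Real.log (5 / 4 * (M * N / δ)) + 4 * Real.log t := by
  have hM' : (0 : ℝ) < M := by exact_mod_cast hM
  have hN' : (0 : ℝ) < N := by exact_mod_cast (by omega : 0 < N)
  have ht' : (0 : ℝ) < t := by exact_mod_cast ht
  rw [logTerm, Real.log_mul (by positivity) (by positivity), Real.log_pow]
  norm_num

lemma two_mul_radius_sq (hM : 1 ≤ M) (hN : 2 ≤ N) {δ : ℝ} (hδ : 0 < δ) (hδ' : δ < 1) {y t : ℕ}
    (hy : y ≠ 0) (ht : 1 ≤ t) : 2 * y * radius M N δ y t ^ 2 = logTerm M N δ t := by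
  have hy' : (y : ℝ) ≠ 0 := by exact_mod_cast hy
  rw [radius, Real.sq_sqrt (mul_nonneg (by positivity) (logTerm_nonneg hM hN hδ hδ' ht))]
  field_simp

lemma radius_nonneg (M N : ℕ) (δ : ℝ) (y t : ℕ) : 0 ≤ radius M N δ y t := Real.sqrt_nonneg _

/-! ### One state: uncertainty, gaps and radii. -/

namespace State

variable (tb : TieBreaking M N) (ε δ : ℝ) (s : State M N)

variable {s} in
-- An unobserved action has radius `⊤`; hence once the wider of the two compared workers has been
-- observed, both have finite bounds.
lemma y_ne_zero_of_rad_le {δ : ℝ} {a b : Fin N × Fin M} (hb : s.y b ≠ 0)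
    (h : s.rad δ a ≤ s.rad δ b) : s.y a ≠ 0 := by
  intro ha
  rw [rad, rad, beta, if_pos ha, beta_of_ne_zero _ _ _ hb, top_le_iff] at h
  exact EReal.coe_ne_top _ h

variable {s} in
lemma ucb_eq {a : Fin N × Fin M} (ha : s.y a ≠ 0) :
    s.ucb δ a = ((s.est a + radius M N δ (s.y a) s.t : ℝ) : EReal) := by
  rw [ucb, rad, beta_of_ne_zero _ _ _ ha, EReal.coe_add]

variable {s} in
lemma lcb_eq {a : Fin N × Fin M} (ha : s.y a ≠ 0) :
    s.lcb δ a = ((s.est a - radius M N δ (s.y a) s.t : ℝ) : EReal) := by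
  rw [lcb, rad, beta_of_ne_zero _ _ _ ha, EReal.coe_sub]

variable {s} in
lemma ucb_eq_top {a : Fin N × Fin M} (ha : s.y a = 0) : s.ucb δ a = ⊤ := by
  simp [ucb, rad, beta, ha]

variable {s} in
lemma lcb_eq_bot {a : Fin N × Fin M} (ha : s.y a = 0) : s.lcb δ a = ⊥ := by
  simp [lcb, rad, beta, ha]

lemma est_le_best [NeZero N] (j : Fin M) (i : Fin N) : s.est (i, j) ≤ s.est (s.best tb j, j) := by
  have := (tb.best.pick_mem_maximizers (s.t, j) Finset.univ_nonempty
    (fun i => (s.est (i, j) : EReal))).2 i (Finset.mem_univ i)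
  exact EReal.coe_le_coe_iff.1 this

lemma challenger_spec (hN : 2 ≤ N) (j : Fin M) :
    s.challenger tb δ j ≠ s.best tb j ∧
      ∀ i, i ≠ s.best tb j → s.ucb δ (i, j) ≤ s.ucb δ (s.challenger tb δ j, j) := by
  have hne : (Finset.univ.erase (s.best tb j)).Nonempty := by
    rw [← Finset.card_pos, Finset.card_erase_of_mem (Finset.mem_univ _)]
    simp; omega
  have := tb.challenger.pick_mem_maximizers (s.t, j) hne (fun i => s.ucb δ (i, j))
  exact ⟨(Finset.mem_erase.1 this.1).1, fun i hi => this.2 i (by simp [hi])⟩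

variable {s} in
lemma pickedTask_mem (hs : s.R.Nonempty) : s.pickedTask tb δ ∈ s.R :=
  (tb.task.pick_mem_maximizers s.t hs _).1

lemma pickedAction_spec :
    ((s.pickedAction tb δ = (s.best tb (s.pickedTask tb δ), s.pickedTask tb δ)) ∨
      (s.pickedAction tb δ = (s.challenger tb δ (s.pickedTask tb δ), s.pickedTask tb δ))) ∧
    s.rad δ (s.best tb (s.pickedTask tb δ), s.pickedTask tb δ) ≤ s.rad δ (s.pickedAction tb δ) ∧
    s.rad δ (s.challenger tb δ (s.pickedTask tb δ), s.pickedTask tb δ) ≤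
      s.rad δ (s.pickedAction tb δ) := by
  have h := tb.wider.pick_mem_maximizers (s.t, s.pickedTask tb δ)
    (s := {s.best tb (s.pickedTask tb δ), s.challenger tb δ (s.pickedTask tb δ)}) (by simp)
    (fun i => s.rad δ (i, s.pickedTask tb δ))
  refine ⟨?_, h.2 _ (by simp), h.2 _ (by simp)⟩
  have h1 := h.1
  simp only [Finset.mem_insert, Finset.mem_singleton] at h1
  simp only [pickedAction, Prod.mk.injEq, and_true]
  exact h1

/-- All open tasks still have an uncertainty above `ε`. -/
def OpenUncertain : Prop := ∀ j ∈ s.R, (ε : EReal) < s.uncertainty tb δ j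

lemma radius_le_of_rad_le {δ : ℝ} {a b : Fin N × Fin M} (ha : s.y a ≠ 0) (hb : s.y b ≠ 0)
    (h : s.rad δ a ≤ s.rad δ b) : radius M N δ (s.y a) s.t ≤ radius M N δ (s.y b) s.t := by
  rw [rad, rad, beta_of_ne_zero _ _ _ ha, beta_of_ne_zero _ _ _ hb] at h
  exact EReal.coe_le_coe_iff.1 h

variable {tb ε δ s} in
/-- An action that is performed although it has been observed has a radius above `ε / 2`. -/
lemma half_lt_radius [NeZero N] (hR : s.R.Nonempty) (ho : s.OpenUncertain tb ε δ)
    (hy : s.y (s.pickedAction tb δ) ≠ 0) :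
    ε / 2 < radius M N δ (s.y (s.pickedAction tb δ)) s.t := by
  obtain ⟨-, h1, h2⟩ := s.pickedAction_spec tb δ
  have hu := ho _ (pickedTask_mem tb δ hR)
  set q := s.pickedTask tb δ
  have y1 := y_ne_zero_of_rad_le hy h1
  have y2 := y_ne_zero_of_rad_le hy h2
  have r1 := s.radius_le_of_rad_le y1 hy h1
  have r2 := s.radius_le_of_rad_le y2 hy h2
  rw [uncertainty, ucb_eq _ y2, lcb_eq _ y1, ← EReal.coe_sub, EReal.coe_lt_coe_iff] at hu
  have := s.est_le_best tb q (s.challenger tb δ q)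
  linarith

/-- The confidence interval of the action `a` contains `m a`. -/
def Accurate (m : Fin N × Fin M → ℝ) (a : Fin N × Fin M) : Prop :=
  s.y a ≠ 0 → |s.est a - m a| ≤ radius M N δ (s.y a) s.t

variable {tb ε δ s} in
-- With `B` the wider radius, uncertainty above `ε > 0` places the estimates of `h` and `ℓ` within
-- `2B` of each other. The challenger's upper bound controls every worker other than `h`. Passing
-- from estimates to means costs another `2B`.
lemma gap_le_radius [NeZero N] (hN : 2 ≤ N) (hε : 0 < ε) (hR : s.R.Nonempty)
    (ho : s.OpenUncertain tb ε δ) (hy : s.y (s.pickedAction tb δ) ≠ 0) {μ : Fin N → Fin M → ℝ}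
    (hacc : ∀ a, s.Accurate δ (fun a => μ a.1 a.2) a) :
    gap μ (s.pickedAction tb δ).1 (s.pickedAction tb δ).2 ≤
      4 * radius M N δ (s.y (s.pickedAction tb δ)) s.t := by
  obtain ⟨hp, h1, h2⟩ := s.pickedAction_spec tb δ
  have hu := ho _ (pickedTask_mem tb δ hR)
  set q := s.pickedTask tb δ
  obtain ⟨hne, hc⟩ := s.challenger_spec tb δ hN q
  have y1 := y_ne_zero_of_rad_le hy h1
  have y2 := y_ne_zero_of_rad_le hy h2
  have r1 := s.radius_le_of_rad_le y1 hy h1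
  have r2 := s.radius_le_of_rad_le y2 hy h2
  rw [uncertainty, ucb_eq _ y2, lcb_eq _ y1, ← EReal.coe_sub, EReal.coe_lt_coe_iff] at hu
  have he := s.est_le_best tb q (s.challenger tb δ q)
  have a1 := abs_le.1 (hacc _ y1)
  have a2 := abs_le.1 (hacc _ y2)
  set B := radius M N δ (s.y (s.pickedAction tb δ)) s.t
  set h := s.best tb q
  set l := s.challenger tb δ q
  dsimp only at a1 a2
  -- An unobserved competitor would have upper bound `⊤` and beat the challenger, whose bound is
  -- finite.
  have hother : ∀ i, i ≠ h → μ i q ≤ s.est (l, q) + B := by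
    intro i hi
    have hci := hc i hi
    rw [ucb_eq _ y2] at hci
    by_cases yi : s.y (i, q) = 0
    · rw [ucb_eq_top _ yi, top_le_iff] at hci
      exact absurd hci (EReal.coe_ne_top _)
    · rw [ucb_eq _ yi, EReal.coe_le_coe_iff] at hci
      have ai := abs_le.1 (hacc _ yi)
      dsimp only at ai
      linarith
  have hsup : ∀ c, (∀ i, μ i q ≤ c) → (⨆ i', μ i' q) ≤ c := fun c hc => ciSup_le hc
  have hsup' : ∀ i i' : Fin N, i' ≠ i → μ i' q ≤ ⨆ i' : {i' : Fin N // i' ≠ i}, μ i' q :=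
    fun i i' hi => le_ciSup (f := fun i' : {i' : Fin N // i' ≠ i} => μ i' q)
      (Set.finite_range _).bddAbove ⟨i', hi⟩
  rcases hp with hp | hp <;> rw [hp] <;> dsimp only [gap]
  · split_ifs with hb
    · have := hsup' h l hne
      linarith
    · have := hsup (μ h q + 2 * B) (fun i => by
        by_cases hi : i = h
        · subst hi; linarith
        · have := hother i hi; linarith)
      linarith
  · split_ifs with hb
    · have := hsup' l h hne.symm
      linarith
    · have := hsup (μ l q + 4 * B) (fun i => by
        by_cases hi : i = h
        · subst hi; linarith
        · have := hother i hi; linarith)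
      linarith

/-- Committing to the empirically best worker is correct up to `ε` if the upper confidence bound of
a best worker and the lower confidence bound of the selected worker are valid. -/
lemma best_eps_optimal (hN : 2 ≤ N) {j : Fin M} (hu : s.uncertainty tb δ j ≤ (ε : EReal))
    (hε : 0 < ε) {m : Fin N → ℝ} {i : Fin N}
    (hup : s.y (i, j) ≠ 0 → m i ≤ s.est (i, j) + radius M N δ (s.y (i, j)) s.t)
    (hlow : s.best tb j ≠ i → s.y (s.best tb j, j) ≠ 0 →
      s.est (s.best tb j, j) - radius M N δ (s.y (s.best tb j, j)) s.t ≤ m (s.best tb j)) :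
    m i - m (s.best tb j) ≤ ε := by
  obtain ⟨hne, hc⟩ := s.challenger_spec tb δ hN j
  by_cases hi : s.best tb j = i
  · rw [hi]; linarith
  -- A closed task has finite uncertainty; an unobserved `h` or challenger would make it `⊤`.
  have y1 : s.y (s.best tb j, j) ≠ 0 := by
    intro h0
    rw [uncertainty, lcb_eq_bot _ h0] at hu
    by_cases h2 : s.y (s.challenger tb δ j, j) = 0
    · rw [ucb_eq_top _ h2] at hu; simp at hu
    · rw [ucb_eq _ h2] at hu; simp at hu
  have y2 : s.y (s.challenger tb δ j, j) ≠ 0 := by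
    intro h0
    rw [uncertainty, lcb_eq _ y1, ucb_eq_top _ h0, EReal.top_sub_coe, top_le_iff] at hu
    exact EReal.coe_ne_top _ hu
  have hci := hc i (Ne.symm hi)
  rw [uncertainty, ucb_eq _ y2, lcb_eq _ y1, ← EReal.coe_sub, EReal.coe_le_coe_iff] at hu
  rw [ucb_eq _ y2] at hci
  by_cases yi : s.y (i, j) = 0
  · rw [ucb_eq_top _ yi, top_le_iff] at hci
    exact absurd hci (EReal.coe_ne_top _)
  · rw [ucb_eq _ yi, EReal.coe_le_coe_iff] at hci
    have := hup yi
    have := hlow hi y1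
    linarith

end State

/-! ### Invariants along a run, and counting of picks. -/

section Run

variable {G : SimpleGraph (Fin N × Fin M)} (D : DominatingScheme G) (tb : TieBreaking M N)
  (ε δ : ℝ) (x : ℕ → Fin N → Fin M → ℝ)

/-- In state `s`, the next step of the algorithm reveals the value of the action `a`. -/
def Observes (s : State M N) (a : Fin N × Fin M) : Prop :=
  s.R ≠ ∅ ∧ a ∈ D.dominated (D.dominator (s.pickedAction tb δ))

open Classical in
lemma step_y (w : Fin N → Fin M → ℝ) (s : State M N) (a : Fin N × Fin M) :
    (s.step D tb ε δ w).y a = s.y a + if Observes D tb δ s a then 1 else 0 := by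
  by_cases h : s.R = ∅
  · simp [State.step, h, Observes]
  · simp only [State.step, h, if_false, State.commit, State.observe, Observes, ne_eq,
      not_false_eq_true, true_and]
    split_ifs <;> rfl

open Classical in
lemma step_total (w : Fin N → Fin M → ℝ) (s : State M N) (a : Fin N × Fin M) :
    (s.step D tb ε δ w).total a = s.total a + if Observes D tb δ s a then w a.1 a.2 else 0 := by
  by_cases h : s.R = ∅
  · simp [State.step, h, Observes]
  · simp only [State.step, h, if_false, State.commit, State.observe, Observes, ne_eq,
      not_false_eq_true, true_and]
    split_ifs <;> simp

lemma step_t (w : Fin N → Fin M → ℝ) {s : State M N} (h : s.R ≠ ∅) :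
    (s.step D tb ε δ w).t = s.t + 1 := by
  simp [State.step, h, State.commit, State.observe]

lemma step_R_subset (w : Fin N → Fin M → ℝ) (s : State M N) : (s.step D tb ε δ w).R ⊆ s.R := by
  by_cases h : s.R = ∅
  · simp [State.step, h]
  · simp [State.step, h, State.commit, State.observe]

/-- Each closed task contributes at most one new worker. This is the invariant behind the team size
`M`. -/
lemma step_card (w : Fin N → Fin M → ℝ) (s : State M N) :
    (s.step D tb ε δ w).S.card + (s.step D tb ε δ w).R.card ≤ s.S.card + s.R.card := by
  classical
  by_cases h : s.R = ∅
  · simp [State.step, h]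
  · simp only [State.step, h, if_false, State.commit]
    have aux : ∀ s' : State M N, (s'.S ∪ (s'.R.filter fun j =>
        s'.uncertainty tb δ j ≤ (ε : EReal)).image (s'.best tb)).card +
        (s'.R \ s'.R.filter fun j => s'.uncertainty tb δ j ≤ (ε : EReal)).card ≤
          s'.S.card + s'.R.card := by
      intro s'
      set done := s'.R.filter fun j => s'.uncertainty tb δ j ≤ (ε : EReal)
      have h1 : (s'.R \ done).card + done.card = s'.R.card :=
        Finset.card_sdiff_add_card_eq_card (Finset.filter_subset _ _)
      have h2 : (s'.S ∪ done.image (s'.best tb)).card ≤ s'.S.card + done.card :=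
        (Finset.card_union_le _ _).trans (by gcongr; exact Finset.card_image_le)
      omega
    set s' := s.observe (D.dominated (D.dominator (s.pickedAction tb δ))) w
    change _ ≤ s'.S.card + s'.R.card
    convert aux s'

lemma openUncertain_step (w : Fin N → Fin M → ℝ) (s : State M N) (h : s.OpenUncertain tb ε δ) :
    (s.step D tb ε δ w).OpenUncertain tb ε δ := by
  by_cases h0 : s.R = ∅
  · simpa [State.step, h0] using h
  · simp only [State.step, h0, if_false]
    intro j hj
    simp only [State.commit, Finset.mem_sdiff, Finset.mem_filter, not_and, not_le] at hj
    exact hj.2 hj.1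

lemma step_S_subset (w : Fin N → Fin M → ℝ) (s : State M N) : s.S ⊆ (s.step D tb ε δ w).S := by
  by_cases h : s.R = ∅
  · simp [State.step, h]
  · simp only [State.step, h, if_false, State.commit, State.observe]
    exact Finset.subset_union_left

/-- A task is closed only when its empirically best worker joins the team. -/
lemma best_mem_of_closed (w : Fin N → Fin M → ℝ) (s : State M N) {j : Fin M} (hj : j ∈ s.R)
    (hj' : j ∉ (s.step D tb ε δ w).R) :
    (s.step D tb ε δ w).best tb j ∈ (s.step D tb ε δ w).S ∧
      (s.step D tb ε δ w).uncertainty tb δ j ≤ (ε : EReal) := by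
  have h : s.R ≠ ∅ := Finset.ne_empty_of_mem hj
  simp only [State.step, h, if_false] at hj' ⊢
  set s' := s.observe (D.dominated (D.dominator (s.pickedAction tb δ))) w
  have hR : j ∈ s'.R := hj
  simp only [State.commit, Finset.mem_sdiff, Finset.mem_filter, not_and] at hj'
  have hu : s'.uncertainty tb δ j ≤ (ε : EReal) := by
    by_contra hu
    exact hj' hR fun _ => hu
  -- Committing changes only `R` and `S`, which neither `best` nor `uncertainty` reads, so both are
  -- unchanged by definition.
  refine ⟨?_, hu⟩
  simp only [State.commit, Finset.mem_union, Finset.mem_image, Finset.mem_filter]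
  exact Or.inr ⟨j, ⟨hR, hu⟩, rfl⟩

lemma run_R_antitone : Antitone fun k => (aexpSelect D tb ε δ x k).R :=
  antitone_nat_of_succ_le fun k => step_R_subset D tb ε δ (x k) _

lemma run_nonempty {k l : ℕ} (hkl : k ≤ l) (h : (aexpSelect D tb ε δ x l).R ≠ ∅) :
    (aexpSelect D tb ε δ x k).R ≠ ∅ := by
  obtain ⟨j, hj⟩ := Finset.nonempty_iff_ne_empty.2 h
  exact Finset.ne_empty_of_mem (run_R_antitone D tb ε δ x hkl hj)

lemma run_t {k : ℕ} (h : (aexpSelect D tb ε δ x k).R ≠ ∅) : (aexpSelect D tb ε δ x k).t = k := by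
  induction k with
  | zero => rfl
  | succ k ih =>
    have h' := run_nonempty D tb ε δ x (Nat.le_succ k) h
    rw [aexpSelect, step_t D tb ε δ _ h', ih h']

/-- The clock freezes when no task is open, so it agrees with the step index only up to the closing
step. That step itself is included here, since correctness evaluates the radii there. -/
lemma run_t_succ {k : ℕ} (h : (aexpSelect D tb ε δ x k).R ≠ ∅) :
    (aexpSelect D tb ε δ x (k + 1)).t = k + 1 := by
  rw [aexpSelect, step_t D tb ε δ _ h, run_t D tb ε δ x h]

lemma run_y_mono (a : Fin N × Fin M) : Monotone fun k => (aexpSelect D tb ε δ x k).y a :=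
  monotone_nat_of_le_succ fun k => by
    rw [aexpSelect, step_y]; exact Nat.le_add_right _ _

lemma run_y_le (k : ℕ) (a : Fin N × Fin M) : (aexpSelect D tb ε δ x k).y a ≤ k := by
  induction k with
  | zero => simp [aexpSelect, State.init]
  | succ k ih => rw [aexpSelect, step_y]; split_ifs <;> omega

lemma run_card (k : ℕ) :
    (aexpSelect D tb ε δ x k).S.card + (aexpSelect D tb ε δ x k).R.card ≤ M := by
  induction k with
  | zero => simp [aexpSelect, State.init]
  | succ k ih => exact (step_card D tb ε δ _ _).trans ih

lemma run_openUncertain (k : ℕ) : (aexpSelect D tb ε δ x k).OpenUncertain tb ε δ := by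
  induction k with
  | zero =>
    intro j _
    rw [State.uncertainty, State.ucb_eq_top _ rfl, State.lcb_eq_bot _ rfl]
    simp
  | succ k ih => exact openUncertain_step D tb ε δ _ _ ih

lemma run_y_succ_pickedAction {k : ℕ} (h : (aexpSelect D tb ε δ x k).R ≠ ∅) :
    (aexpSelect D tb ε δ x (k + 1)).y ((aexpSelect D tb ε δ x k).pickedAction tb δ) =
      (aexpSelect D tb ε δ x k).y ((aexpSelect D tb ε δ x k).pickedAction tb δ) + 1 := by
  rw [aexpSelect, step_y, if_pos ⟨h, D.mem_dominated _⟩]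

/-- The number of steps at which the picked action has been observed rarely is small. -/
lemma card_le_sum_of_y_le (A : Finset ℕ) (hA : ∀ k ∈ A, (aexpSelect D tb ε δ x k).R ≠ ∅)
    (V : Fin N × Fin M → ℝ) (hV0 : ∀ a, 0 ≤ V a)
    (hV : ∀ k ∈ A, ((aexpSelect D tb ε δ x k).y ((aexpSelect D tb ε δ x k).pickedAction tb δ) : ℝ) ≤
      V ((aexpSelect D tb ε δ x k).pickedAction tb δ)) :
    (A.card : ℝ) ≤ ∑ a, (V a + 1) := by
  set p : ℕ → Fin N × Fin M := fun k => (aexpSelect D tb ε δ x k).pickedAction tb δ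
  have h1 : A.card = ∑ a, (A.filter fun k => p k = a).card :=
    Finset.card_eq_sum_card_fiberwise (fun _ _ => Finset.mem_coe.2 (Finset.mem_univ _))
  rw [h1, Nat.cast_sum]
  refine Finset.sum_le_sum fun a _ => ?_
  have h2 : (A.filter fun k => p k = a).card ≤ (Finset.range (⌊V a⌋₊ + 1)).card := by
    have hlt : ∀ k ∈ A, p k = a → ∀ l, k < l →
        (aexpSelect D tb ε δ x k).y a < (aexpSelect D tb ε δ x l).y a := by
      intro k hk hpk l hkl
      have := run_y_succ_pickedAction D tb ε δ x (hA k hk)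
      change _ = (aexpSelect D tb ε δ x k).y (p k) + 1 at this
      change (aexpSelect D tb ε δ x (k + 1)).y (p k) = _ at this
      rw [hpk] at this
      have := run_y_mono D tb ε δ x a (Nat.succ_le_of_lt hkl)
      simp only [Nat.succ_eq_add_one] at this
      omega
    -- Picking `a` strictly increases its count, so the counts at distinct picks of `a` are distinct
    -- integers in `[0, ⌊V a⌋]`.
    refine Finset.card_le_card_of_injOn (fun k => (aexpSelect D tb ε δ x k).y a) ?_ ?_
    · intro k hk
      obtain ⟨hk, hpk⟩ := Finset.mem_filter.1 (Finset.mem_coe.1 hk)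
      have := hV k hk
      change ((aexpSelect D tb ε δ x k).y (p k) : ℝ) ≤ V (p k) at this
      rw [hpk] at this
      simp only [Finset.coe_range, Set.mem_Iio]
      exact Nat.lt_succ_of_le (Nat.le_floor this)
    · intro k hk l hl hkl
      obtain ⟨hk, hpk⟩ := Finset.mem_filter.1 (Finset.mem_coe.1 hk)
      obtain ⟨hl, hpl⟩ := Finset.mem_filter.1 (Finset.mem_coe.1 hl)
      rcases lt_trichotomy k l with h | h | h
      · exact absurd hkl (hlt k hk hpk l h).ne
      · exact h
      · exact absurd hkl (hlt l hl hpl k h).ne'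
  rw [Finset.card_range] at h2
  calc ((A.filter fun k => p k = a).card : ℝ) ≤ (⌊V a⌋₊ + 1 : ℕ) := by exact_mod_cast h2
    _ ≤ V a + 1 := by push_cast; gcongr; exact Nat.floor_le (hV0 a)

/-- If the confidence bounds never fail (on the relevant side), each closed task is covered by an
`ε`-best worker. -/
lemma run_eps_optimal (hN : 2 ≤ N) (hε : 0 < ε) {μ : Fin N → Fin M → ℝ} (b : Fin M → Fin N)
    (hb : ∀ i j, μ i j ≤ μ (b j) j)
    (hup : ∀ k j, (aexpSelect D tb ε δ x k).y (b j, j) ≠ 0 →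
      μ (b j) j ≤ (aexpSelect D tb ε δ x k).est (b j, j) +
        radius M N δ ((aexpSelect D tb ε δ x k).y (b j, j)) k)
    (hlow : ∀ k i j, i ≠ b j → (aexpSelect D tb ε δ x k).y (i, j) ≠ 0 →
      (aexpSelect D tb ε δ x k).est (i, j) -
        radius M N δ ((aexpSelect D tb ε δ x k).y (i, j)) k ≤ μ i j) (k : ℕ) (j : Fin M)
    (hj : j ∉ (aexpSelect D tb ε δ x k).R) :
    ∃ i ∈ (aexpSelect D tb ε δ x k).S, (⨆ i', μ i' j) - μ i j ≤ ε := by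
  have : NeZero N := ⟨by omega⟩
  induction k with
  | zero => simp [aexpSelect, State.init] at hj
  | succ k ih =>
    by_cases hk : j ∈ (aexpSelect D tb ε δ x k).R
    · obtain ⟨h1, h2⟩ := best_mem_of_closed D tb ε δ (x k) _ hk hj
      refine ⟨_, h1, ?_⟩
      have ht := run_t_succ D tb ε δ x (Finset.ne_empty_of_mem hk)
      have hs : (⨆ i', μ i' j) ≤ μ (b j) j := ciSup_le fun i => hb i j
      have := State.best_eps_optimal tb ε δ (aexpSelect D tb ε δ x (k + 1)) hN h2 hε
        (m := fun i => μ i j) (i := b j)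
        (fun hy => by rw [ht]; exact hup (k + 1) j hy)
        (fun hi hy => by rw [ht]; exact hlow (k + 1) _ j hi hy)
      change _ - μ ((aexpSelect D tb ε δ x (k + 1)).best tb j) j ≤ ε
      linarith
    · obtain ⟨i, hi, h⟩ := ih hk
      exact ⟨i, step_S_subset D tb ε δ (x k) _ hi, h⟩

end Run

/-! ### Resolving `T ≤ A + K log T`, and termination. -/

/-- Resolves an inequality between `T` and `log T`. -/
lemma le_of_le_add_mul_log {T A K : ℝ} (hT : 0 < T) (hK : 0 < K) (h : T ≤ A + K * Real.log T) :
    T ≤ 2 * A + 2 * K * Real.log (2 * K) := by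
  -- This is `log u ≤ u - 1` at `u = T / (2K)`, scaled so that `K log T` absorbs exactly half of
  -- `T`.
  have h1 : Real.log T ≤ T / (2 * K) + Real.log (2 * K) := by
    have h2 := Real.log_le_sub_one_of_pos (show 0 < T / (2 * K) by positivity)
    rw [Real.log_div hT.ne' (by positivity)] at h2
    linarith
  have h3 : K * Real.log T ≤ K * (T / (2 * K) + Real.log (2 * K)) := by gcongr
  have h4 : K * (T / (2 * K) + Real.log (2 * K)) = T / 2 + K * Real.log (2 * K) := by
    field_simp
  linarith

section Termination

variable {G : SimpleGraph (Fin N × Fin M)} (D : DominatingScheme G) (tb : TieBreaking M N)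
  (ε δ : ℝ) (x : ℕ → Fin N → Fin M → ℝ)

/-- The algorithm terminates on every sequence of values. -/
lemma exists_run_eq_empty (hM : 1 ≤ M) (hN : 2 ≤ N) (hε : 0 < ε) (hδ : 0 < δ) (hδ' : δ < 1) :
    ∃ k, (aexpSelect D tb ε δ x k).R = ∅ := by
  have : NeZero N := ⟨by omega⟩
  by_contra! hne
  have hne' : ∀ k, (aexpSelect D tb ε δ x k).R ≠ ∅ := fun k => (hne k).ne_empty
  -- Only the `ε/2` bound on the radius enters, so no accuracy of the estimates is required.
  have key : ∀ T : ℕ, 1 ≤ T → (T : ℝ) ≤ M * N * (2 / ε ^ 2 * logTerm M N δ T + 1) := by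
    intro T hT
    have hL := logTerm_nonneg hM hN hδ hδ' hT
    have := card_le_sum_of_y_le D tb ε δ x (Finset.range T) (fun k _ => hne' k)
      (fun _ => 2 / ε ^ 2 * logTerm M N δ T) (fun _ => by positivity) (fun k hk => by
        by_cases hy : (aexpSelect D tb ε δ x k).y ((aexpSelect D tb ε δ x k).pickedAction tb δ) = 0
        · rw [hy]; push_cast; positivity
        have hr := State.half_lt_radius (hne k) (run_openUncertain D tb ε δ x k) hy
        have hk1 : 1 ≤ k := (Nat.one_le_iff_ne_zero.2 hy).trans (run_y_le D tb ε δ x k _)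
        rw [run_t D tb ε δ x (hne' k)] at hr
        have h2 := two_mul_radius_sq hM hN hδ hδ' hy hk1
        have h3 := logTerm_mono hM hN hδ hδ' hk1 (Finset.mem_range.1 hk).le
        set y := (aexpSelect D tb ε δ x k).y ((aexpSelect D tb ε δ x k).pickedAction tb δ)
        have h4 : (ε / 2) ^ 2 ≤ radius M N δ y k ^ 2 := by gcongr
        have h5 : (2 * y : ℝ) * (ε / 2) ^ 2 ≤ logTerm M N δ T := by
          calc _ ≤ (2 * y : ℝ) * radius M N δ y k ^ 2 := by gcongr
            _ ≤ _ := by rw [h2]; exact h3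
        rw [div_mul_eq_mul_div, le_div_iff₀ (by positivity)]
        nlinarith)
    simp only [Finset.card_range, Finset.sum_const, Finset.card_univ, Fintype.card_prod,
      Fintype.card_fin, nsmul_eq_mul] at this
    push_cast at this
    linarith
  have hM' : (0 : ℝ) < M := by exact_mod_cast hM
  have hN' : (0 : ℝ) < N := by exact_mod_cast (by omega : 0 < N)
  set c := Real.log (5 / 4 * (M * N / δ))
  set K : ℝ := M * N * (2 / ε ^ 2) * 4
  set A : ℝ := M * N * (2 / ε ^ 2 * c + 1)
  have hK : 0 < K := by positivity
  have bound : ∀ T : ℕ, 1 ≤ T → (T : ℝ) ≤ 2 * A + 2 * K * Real.log (2 * K) := by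
    intro T hT
    refine le_of_le_add_mul_log (by exact_mod_cast hT) hK ?_
    have := key T hT
    rw [logTerm_eq hM hN hδ hT] at this
    calc (T : ℝ) ≤ _ := this
      _ = _ := by ring
  obtain ⟨n, hn⟩ := exists_nat_gt (2 * A + 2 * K * Real.log (2 * K))
  have := bound (n + 1) (by omega)
  push_cast at this
  linarith

end Termination

/-! ### Measurability of the run. -/

section Measurability

variable {Ω α β : Type*} {_mΩ : MeasurableSpace Ω}

/-- All level sets of `f` are measurable (the notion of measurability that is used for functions
with countably many values). -/
def LevelMeasurable {Ω α : Type*} [MeasurableSpace Ω] (f : Ω → α) : Prop :=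
  ∀ c, MeasurableSet {ω | f ω = c}

lemma LevelMeasurable.const (c : α) : LevelMeasurable fun _ : Ω => c := fun _ => .const _

/-- Splitting over the countably many values of `f` replaces joint measurability. Arbitrary
tie-breaking rules are thus allowed, with no measurable structure on their values. -/
lemma LevelMeasurable.setOf_bind [Countable α] {f : Ω → α} (hf : LevelMeasurable f)
    {p : α → Ω → Prop} (hp : ∀ a, MeasurableSet {ω | p a ω}) : MeasurableSet {ω | p (f ω) ω} := by
  have : {ω | p (f ω) ω} = ⋃ a, {ω | f ω = a} ∩ {ω | p a ω} := by
    ext ω; simp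
  rw [this]
  exact MeasurableSet.iUnion fun a => (hf a).inter (hp a)

lemma LevelMeasurable.bind [Countable α] {f : Ω → α} (hf : LevelMeasurable f)
    {g : α → Ω → β} (hg : ∀ a, LevelMeasurable (g a)) : LevelMeasurable fun ω => g (f ω) ω :=
  fun c => hf.setOf_bind fun a => hg a c

lemma LevelMeasurable.comp [Countable α] {f : Ω → α} (hf : LevelMeasurable f) (g : α → β) :
    LevelMeasurable fun ω => g (f ω) :=
  hf.bind fun a => .const (g a)

lemma LevelMeasurable.measurable_bind [Countable α] [MeasurableSpace β] {f : Ω → α}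
    (hf : LevelMeasurable f) {g : α → Ω → β} (hg : ∀ a, Measurable (g a)) :
    Measurable fun ω => g (f ω) ω :=
  fun _ hs => hf.setOf_bind (p := fun a ω => g a ω ∈ _) fun a => hg a hs

lemma LevelMeasurable.measurable_comp [Countable α] [MeasurableSpace β] {f : Ω → α}
    (hf : LevelMeasurable f) (g : α → β) : Measurable fun ω => g (f ω) :=
  hf.measurable_bind fun a => measurable_const (a := g a)

lemma levelMeasurable_maximizers {ι : Type*} [Finite ι] {A : Ω → Finset ι}
    (hA : LevelMeasurable A) {F : ι → Ω → EReal} (hF : ∀ i, Measurable (F i)) :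
    LevelMeasurable fun ω => maximizers (A ω) fun i => F i ω := by
  refine hA.bind (g := fun A ω => maximizers A fun i => F i ω) fun A B => ?_
  have : {ω | maximizers A (fun i => F i ω) = B} =
      {ω | ∀ i, i ∈ A ∧ (∀ i', i' ∈ A → F i' ω ≤ F i ω) ↔ i ∈ B} := by
    ext ω
    simp only [Set.mem_ofPred_eq, Finset.ext_iff, mem_maximizers]
  rw [this]
  refine measurableSet_setOfPred.2 (Measurable.forall fun i => Measurable.iff (Measurable.and
    measurable_const (Measurable.forall fun i' => Measurable.imp measurable_const ?_))
    measurable_const)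
  exact measurableSet_setOfPred.1 (measurableSet_le (hF i') (hF i))

/-- The variables that drive the algorithm are measurable functions of the outcome. -/
structure MeasurableState {Ω : Type*} [MeasurableSpace Ω] (st : Ω → State M N) : Prop where
  t : LevelMeasurable fun ω => (st ω).t
  R : LevelMeasurable fun ω => (st ω).R
  y : ∀ a, LevelMeasurable fun ω => (st ω).y a
  total : ∀ a, Measurable fun ω => (st ω).total a

namespace MeasurableState

variable {st : Ω → State M N} (tb : TieBreaking M N) (ε δ : ℝ)

lemma est (h : MeasurableState st) (a : Fin N × Fin M) : Measurable fun ω => (st ω).est a :=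
  (h.total a).div ((h.y a).measurable_comp fun n : ℕ => (n : ℝ))

lemma rad (h : MeasurableState st) (a : Fin N × Fin M) : Measurable fun ω => (st ω).rad δ a :=
  (h.y a).measurable_bind (g := fun n ω => beta M N δ n (st ω).t) fun n =>
    h.t.measurable_comp (beta M N δ n)

lemma ucb (h : MeasurableState st) (a : Fin N × Fin M) : Measurable fun ω => (st ω).ucb δ a :=
  (h.est a).coe_real_ereal.add (h.rad δ a)

lemma lcb (h : MeasurableState st) (a : Fin N × Fin M) : Measurable fun ω => (st ω).lcb δ a :=
  (h.est a).coe_real_ereal.add (continuous_neg.measurable.comp (h.rad δ a))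

lemma pick (h : MeasurableState st) {ι : Type*} [Finite ι] (sel : Selector (ℕ × Fin M) ι)
    (j : Fin M) {A : Ω → Finset ι}
    (hA : LevelMeasurable A) {F : ι → Ω → EReal} (hF : ∀ i, Measurable (F i)) :
    LevelMeasurable fun ω => sel.pick ((st ω).t, j) (maximizers (A ω) fun i => F i ω) :=
  h.t.bind (g := fun n ω => sel.pick (n, j) (maximizers (A ω) fun i => F i ω)) fun n =>
    (levelMeasurable_maximizers hA hF).comp fun B => sel.pick (n, j) B

lemma best (h : MeasurableState st) (j : Fin M) : LevelMeasurable fun ω => (st ω).best tb j :=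
  h.pick tb.best j (.const _) fun i => (h.est (i, j)).coe_real_ereal

lemma challenger (h : MeasurableState st) (j : Fin M) :
    LevelMeasurable fun ω => (st ω).challenger tb δ j :=
  h.pick tb.challenger j ((h.best tb j).comp fun i => Finset.univ.erase i) fun i => h.ucb δ (i, j)

lemma uncertainty (h : MeasurableState st) (j : Fin M) :
    Measurable fun ω => (st ω).uncertainty tb δ j :=
  ((h.challenger tb δ j).measurable_bind (g := fun i ω => (st ω).ucb δ (i, j)) fun i =>
    h.ucb δ (i, j)).add (continuous_neg.measurable.comp
      ((h.best tb j).measurable_bind (g := fun i ω => (st ω).lcb δ (i, j)) fun i => h.lcb δ (i, j)))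

lemma pickedTask (h : MeasurableState st) : LevelMeasurable fun ω => (st ω).pickedTask tb δ :=
  h.t.bind (g := fun n ω => tb.task.pick n (maximizers (st ω).R fun j => (st ω).uncertainty tb δ j))
    fun n => (levelMeasurable_maximizers h.R fun j => h.uncertainty tb δ j).comp fun B =>
      tb.task.pick n B

lemma pickedAction (h : MeasurableState st) : LevelMeasurable fun ω => (st ω).pickedAction tb δ :=
  (h.pickedTask tb δ).bind (g := fun q ω => (tb.wider.pick ((st ω).t, q)
    (maximizers {(st ω).best tb q, (st ω).challenger tb δ q} fun i => (st ω).rad δ (i, q)), q))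
    fun q => (h.pick tb.wider q
      (A := fun ω => ({(st ω).best tb q, (st ω).challenger tb δ q} : Finset (Fin N)))
      ((h.best tb q).bind
        (g := fun i ω => ({i, (st ω).challenger tb δ q} : Finset (Fin N))) fun i =>
        (h.challenger tb δ q).comp fun i' => ({i, i'} : Finset (Fin N)))
      fun i => h.rad δ (i, q)).comp fun i => (i, q)

lemma commit (h : MeasurableState st) : MeasurableState fun ω => (st ω).commit tb ε δ where
  t := h.t
  y := h.y
  total := h.total
  R := by
    classical
    have : ∀ ω, ((st ω).commit tb ε δ).R =
        (st ω).R.filter fun j => ¬ (st ω).uncertainty tb δ j ≤ (ε : EReal) := by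
      intro ω
      ext j
      simp only [State.commit, Finset.mem_sdiff, Finset.mem_filter]
      tauto
    simp only [this]
    refine h.R.bind (g := fun A ω => A.filter fun j => ¬ (st ω).uncertainty tb δ j ≤ (ε : EReal))
      fun A B => ?_
    simp only [Finset.ext_iff, Finset.mem_filter]
    refine measurableSet_setOfPred.2 (Measurable.forall fun j => Measurable.iff (Measurable.and
      measurable_const (Measurable.not ?_)) measurable_const)
    exact measurableSet_setOfPred.1 (measurableSet_le (h.uncertainty tb δ j) measurable_const)

lemma observe (h : MeasurableState st) {obs : Ω → Finset (Fin N × Fin M)} (ho : LevelMeasurable obs)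
    {x : Ω → Fin N → Fin M → ℝ} (hx : ∀ i j, Measurable fun ω => x ω i j) :
    MeasurableState fun ω => (st ω).observe (obs ω) (x ω) where
  t := h.t.comp fun n => n + 1
  R := h.R
  y a := ho.bind (g := fun A ω => if a ∈ A then (st ω).y a + 1 else (st ω).y a) fun A => by
    split_ifs
    · exact (h.y a).comp fun n => n + 1
    · exact h.y a
  total a := ho.measurable_bind
    (g := fun A ω => if a ∈ A then (st ω).total a + x ω a.1 a.2 else (st ω).total a) fun A => by
    split_ifs
    · exact (h.total a).add (hx _ _)
    · exact h.total a

lemma obs (h : MeasurableState st) {G : SimpleGraph (Fin N × Fin M)} (D : DominatingScheme G) :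
    LevelMeasurable fun ω => D.dominated (D.dominator ((st ω).pickedAction tb δ)) :=
  (h.pickedAction tb δ).comp fun a => D.dominated (D.dominator a)

lemma measurableSet_observes (h : MeasurableState st) {G : SimpleGraph (Fin N × Fin M)} (D : DominatingScheme G)
    (a : Fin N × Fin M) : MeasurableSet {ω | Observes D tb δ (st ω) a} :=
  ((h.R ∅).compl).inter ((h.obs tb δ D).setOf_bind (p := fun A _ => a ∈ A) fun _ => .const _)

/-- The exponential of the centred observations of `a` is a measurable function of the outcome. -/
lemma exp (h : MeasurableState st) (a : Fin N × Fin M) (r c : ℝ) : Measurable fun ω => ENNReal.ofReal (Real.exp (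
    r * ((st ω).total a - (st ω).y a * c) - r ^ 2 / 8 * (st ω).y a)) := by
  have h1 := h.total a
  have h2 := (h.y a).measurable_comp fun n : ℕ => (n : ℝ)
  exact ENNReal.measurable_ofReal.comp (Real.measurable_exp.comp
    (((h1.sub (h2.mul_const c)).const_mul r).sub (h2.const_mul (r ^ 2 / 8))))

lemma ite (h : MeasurableState st) {st' : Ω → State M N} (h' : MeasurableState st')
    {p : Ω → Prop} [DecidablePred p]
    (hp : MeasurableSet {ω | p ω}) : MeasurableState fun ω => if p ω then st ω else st' ω := by
  have hp' : LevelMeasurable fun ω => decide (p ω) := by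
    intro c
    cases c
    · simpa [Set.compl_def] using hp.compl
    · simpa using hp
  constructor
  · convert hp'.bind (g := fun b ω => if b then (st ω).t else (st' ω).t) fun b => ?_ using 2 with ω
    · by_cases hω : p ω <;> simp [hω]
    · cases b <;> simp [h.t, h'.t]
  · convert hp'.bind (g := fun b ω => if b then (st ω).R else (st' ω).R) fun b => ?_ using 2 with ω
    · by_cases hω : p ω <;> simp [hω]
    · cases b <;> simp [h.R, h'.R]
  · intro a
    convert hp'.bind (g := fun b ω => if b then (st ω).y a else (st' ω).y a) fun b => ?_
      using 2 with ω
    · by_cases hω : p ω <;> simp [hω]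
    · cases b <;> simp [h.y, h'.y]
  · intro a
    convert hp'.measurable_bind (g := fun b ω => if b then (st ω).total a else (st' ω).total a)
      fun b => ?_ using 2 with ω
    · by_cases hω : p ω <;> simp [hω]
    · cases b <;> simp [h.total, h'.total]

lemma step (h : MeasurableState st) {G : SimpleGraph (Fin N × Fin M)} (D : DominatingScheme G)
    {x : Ω → Fin N → Fin M → ℝ} (hx : ∀ i j, Measurable fun ω => x ω i j) :
    MeasurableState fun ω => (st ω).step D tb ε δ (x ω) :=
  h.ite ((h.observe (h.obs tb δ D) hx).commit tb ε δ) (h.R ∅)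

end MeasurableState

lemma measurableState_init : MeasurableState fun _ : Ω => State.init M N :=
  ⟨.const _, .const _, fun _ => .const _, fun _ => measurable_const⟩

/-- Only values before step `k` must be measurable, so the lemma applies both to the ambient
σ-algebra and to `past X k`. -/
lemma measurableState_run {G : SimpleGraph (Fin N × Fin M)} (D : DominatingScheme G)
    (tb : TieBreaking M N) (ε δ : ℝ) (x : Ω → ℕ → Fin N → Fin M → ℝ) (k : ℕ)
    (hx : ∀ l < k, ∀ i j, Measurable fun ω => x ω l i j) :
    MeasurableState fun ω => aexpSelect D tb ε δ (x ω) k := by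
  induction k with
  | zero => exact measurableState_init
  | succ k ih => exact (ih fun l hl => hx l (by omega)).step tb ε δ D (hx k (by omega))

end Measurability

/-! ### Hoeffding's bound and one supermartingale step. -/

section Concentration

variable {Ω : Type*} {m mΩ : MeasurableSpace Ω} {P : Measure Ω} [IsProbabilityMeasure P]

/-- Hoeffding's lemma, as a bound on a Lebesgue integral. -/
lemma lintegral_exp_hoeffding_le_one {x : Ω → ℝ} (hx : Measurable x)
    (hx01 : ∀ᵐ ω ∂P, x ω ∈ Set.Icc (0 : ℝ) 1) (r : ℝ) :
    ∫⁻ ω, ENNReal.ofReal (Real.exp (r * (x ω - ∫ ω', x ω' ∂P) - r ^ 2 / 8)) ∂P ≤ 1 := by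
  -- An interval of length one gives variance proxy `1/4`, hence the exponent `r²/8`.
  have h := hasSubgaussianMGF_of_mem_Icc hx.aemeasurable hx01
  have hle := h.mgf_le r
  have hint := h.integrable_exp_mul r
  have e : ∀ ω, Real.exp (r * (x ω - ∫ ω', x ω' ∂P) - r ^ 2 / 8) =
      Real.exp (r * (x ω - ∫ ω', x ω' ∂P)) * Real.exp (-(r ^ 2 / 8)) := by
    intro ω; rw [← Real.exp_add]; ring_nf
  simp only [e]
  rw [← ofReal_integral_eq_lintegral_ofReal (hint.mul_const _)
    (ae_of_all _ fun ω => by positivity), integral_mul_const, ENNReal.ofReal_le_one]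
  calc _ ≤ Real.exp (r ^ 2 / 8) * Real.exp (-(r ^ 2 / 8)) := by
        refine mul_le_mul_of_nonneg_right (hle.trans_eq ?_) (Real.exp_nonneg _)
        congr 1
        norm_num
        ring
    _ = 1 := by rw [← Real.exp_add]; simp

open Classical in
/-- One step of the exponential supermartingale of optionally observed values. -/
lemma lintegral_mul_exp_le (hm : m ≤ mΩ) {Z : Ω → ℝ≥0∞} (hZ : Measurable[m] Z) {A : Set Ω}
    (hA : MeasurableSet[m] A) {x : Ω → ℝ} (hx : Measurable x)
    (hind : Indep m (MeasurableSpace.comap x inferInstance) P)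
    (hx01 : ∀ᵐ ω ∂P, x ω ∈ Set.Icc (0 : ℝ) 1) (r : ℝ) :
    ∫⁻ ω, Z ω * (if ω ∈ A then
      ENNReal.ofReal (Real.exp (r * (x ω - ∫ ω', x ω' ∂P) - r ^ 2 / 8)) else 1) ∂P ≤
      ∫⁻ ω, Z ω ∂P := by
  set g : Ω → ℝ≥0∞ := fun ω => ENNReal.ofReal (Real.exp (r * (x ω - ∫ ω', x ω' ∂P) - r ^ 2 / 8))
  have hg : Measurable[MeasurableSpace.comap x inferInstance] g :=
    Measurable.comp (g := fun z : ℝ =>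
      ENNReal.ofReal (Real.exp (r * (z - ∫ ω', x ω' ∂P) - r ^ 2 / 8))) (by fun_prop)
      (comap_measurable x)
  have hAZ : Measurable[m] (A.indicator Z) := hZ.indicator hA
  -- Only the part of `Z` on `A` meets the new value; it is `m`-measurable, so its integral against
  -- `g` factorizes.
  have e : ∀ ω, Z ω * (if ω ∈ A then g ω else 1) = A.indicator Z ω * g ω + Aᶜ.indicator Z ω := by
    intro ω
    by_cases h : ω ∈ A <;> simp [h]
  change ∫⁻ ω, Z ω * (if ω ∈ A then g ω else 1) ∂P ≤ _
  simp only [e]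
  rw [lintegral_add_right _ ((hZ.mono hm le_rfl).indicator (hm _ hA).compl),
    lintegral_mul_eq_lintegral_mul_lintegral_of_independent_measurableSpace hm
      hx.comap_le hind hAZ hg]
  calc _ ≤ (∫⁻ ω, A.indicator Z ω ∂P) * 1 + ∫⁻ ω, Aᶜ.indicator Z ω ∂P := by
        gcongr; exact lintegral_exp_hoeffding_le_one hx hx01 r
    _ = ∫⁻ ω, Z ω ∂P := by
        rw [mul_one, lintegral_indicator (hm _ hA), lintegral_indicator (hm _ hA).compl,
          lintegral_add_compl _ (hm _ hA)]

end Concentration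

/-! ### Independence of the past and the next value. -/

section Past

variable {Ω : Type*} {X : ℕ → Fin N → Fin M → Ω → ℝ}

/-- The information contained in the values before step `k`. -/
@[reducible]
def past (X : ℕ → Fin N → Fin M → Ω → ℝ) (k : ℕ) : MeasurableSpace Ω :=
  ⨆ p ∈ {p : ℕ × Fin N × Fin M | p.1 < k},
    MeasurableSpace.comap (X p.1 p.2.1 p.2.2) inferInstance

lemma past_le [mΩ : MeasurableSpace Ω] (hX : ∀ t i j, Measurable (X t i j)) (k : ℕ) : past X k ≤ mΩ :=
  iSup₂_le fun p _ => (hX p.1 p.2.1 p.2.2).comap_le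

lemma measurable_past {k l : ℕ} (hl : l < k) (i : Fin N) (j : Fin M) :
    Measurable[past X k] (X l i j) := by
  refine Measurable.mono (comap_measurable (X l i j)) ?_ le_rfl
  exact le_iSup₂_of_le (f := fun (p : ℕ × Fin N × Fin M)
    (_ : p ∈ {p : ℕ × Fin N × Fin M | p.1 < k}) =>
      MeasurableSpace.comap (X p.1 p.2.1 p.2.2) inferInstance) (l, i, j) hl le_rfl

lemma indep_past [MeasurableSpace Ω] {P : Measure Ω} (hX : ∀ t i j, Measurable (X t i j))
    (hindep : iIndepFun (fun p : ℕ × Fin N × Fin M => X p.1 p.2.1 p.2.2) P) (k : ℕ) (i : Fin N)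
    (j : Fin M) : Indep (past X k) (MeasurableSpace.comap (X k i j) inferInstance) P := by
  have h := indep_iSup_of_disjoint (fun p : ℕ × Fin N × Fin M => (hX p.1 p.2.1 p.2.2).comap_le)
    hindep.iIndep (S := {p | p.1 < k}) (T := {(k, i, j)}) (by simp)
  simpa [past] using h

lemma measurableState_run_past {G : SimpleGraph (Fin N × Fin M)} (D : DominatingScheme G)
    (tb : TieBreaking M N) (ε δ : ℝ) (k : ℕ) :
    @MeasurableState M N Ω (past X k) fun ω => aexpSelect D tb ε δ (fun t i j => X t i j ω) k :=
  @measurableState_run M N Ω (past X k) G D tb ε δ (fun ω t i j => X t i j ω) k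
    fun _ hl i j => measurable_past hl i j

end Past

/-! ### Deviation probabilities, uniformly in time. -/

section Deviation

/-- The empirical mean of `a` leaves the confidence interval of step `k` on the side given by the
sign `σ`. -/
def Deviates (δ σ c : ℝ) (s : State M N) (k : ℕ) (a : Fin N × Fin M) : Prop :=
  s.y a ≠ 0 ∧ radius M N δ (s.y a) k < σ * (s.est a - c)

variable {G : SimpleGraph (Fin N × Fin M)} (D : DominatingScheme G) (tb : TieBreaking M N)
  (ε δ : ℝ) {Ω : Type*} [mΩ : MeasurableSpace Ω] {P : Measure Ω} [IsProbabilityMeasure P]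
  {X : ℕ → Fin N → Fin M → Ω → ℝ}

/-- The exponential supermartingale of the observations of the action `a`. -/
lemma lintegral_exp_run_le_one (hX : ∀ t i j, Measurable (X t i j))
    (hX01 : ∀ t i j, ∀ᵐ ω ∂P, X t i j ω ∈ Set.Icc (0 : ℝ) 1)
    (hindep : iIndepFun (fun p : ℕ × Fin N × Fin M => X p.1 p.2.1 p.2.2) P)
    (a : Fin N × Fin M) {c : ℝ} (hc : ∀ t, ∫ ω, X t a.1 a.2 ω ∂P = c) (r : ℝ) (k : ℕ) :
    ∫⁻ ω, ENNReal.ofReal (Real.exp (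
      r * ((aexpSelect D tb ε δ (fun t i j => X t i j ω) k).total a -
        (aexpSelect D tb ε δ (fun t i j => X t i j ω) k).y a * c) -
      r ^ 2 / 8 * (aexpSelect D tb ε δ (fun t i j => X t i j ω) k).y a)) ∂P ≤ 1 := by
  classical
  induction k with
  | zero => simp [aexpSelect, State.init]
  | succ k ih =>
    have hst := measurableState_run_past D tb ε δ (X := X) k
    set st : Ω → State M N := fun ω => aexpSelect D tb ε δ (fun t i j => X t i j ω) k with hstdef
    set Z : Ω → ℝ≥0∞ := fun ω => ENNReal.ofReal (Real.exp (
      r * ((st ω).total a - (st ω).y a * c) - r ^ 2 / 8 * (st ω).y a)) with hZdef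
    have hZ : Measurable[past X k] Z := hst.exp a r c
    -- The decision to observe `a` is read off the state before step `k`, hence is an event of the
    -- past.
    have hA := hst.measurableSet_observes tb δ D a
    have key := lintegral_mul_exp_le (past_le hX k) hZ hA (hX k a.1 a.2)
      (indep_past hX hindep k a.1 a.2) (hX01 k a.1 a.2) r
    rw [hc] at key
    refine le_trans (le_of_eq ?_) (key.trans ih)
    refine lintegral_congr fun ω => ?_
    rw [aexpSelect, step_y, step_total]
    change _ = Z ω * (if Observes D tb δ (st ω) a then _ else 1)
    by_cases ho : Observes D tb δ (st ω) a
    · have ho' : Observes D tb δ (aexpSelect D tb ε δ (fun t i j => X t i j ω) k) a := ho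
      rw [if_pos ho, if_pos ho', if_pos ho', hZdef,
        ← ENNReal.ofReal_mul (Real.exp_nonneg _), ← Real.exp_add]
      congr 2
      push_cast
      ring
    · have ho' : ¬ Observes D tb δ (aexpSelect D tb ε δ (fun t i j => X t i j ω) k) a := ho
      rw [if_neg ho, if_neg ho', if_neg ho', hZdef]
      simp [hstdef]

lemma measurableSet_deviates {k : ℕ} {st : Ω → State M N} (h : MeasurableState st)
    (σ c : ℝ) (a : Fin N × Fin M) : MeasurableSet {ω | Deviates δ σ c (st ω) k a} :=
  (h.y a).setOf_bind (p := fun n ω => n ≠ 0 ∧ radius M N δ n k < σ * ((st ω).est a - c)) fun _ =>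
    (MeasurableSet.const _).inter
      (measurableSet_lt measurable_const (((h.est a).sub_const c).const_mul σ))

/-- Markov's inequality for the supermartingale. Fixing the count `u` lets the slope `r` and the
threshold `v` depend on it. -/
lemma measure_tail_le (hX : ∀ t i j, Measurable (X t i j))
    (hX01 : ∀ t i j, ∀ᵐ ω ∂P, X t i j ω ∈ Set.Icc (0 : ℝ) 1)
    (hindep : iIndepFun (fun p : ℕ × Fin N × Fin M => X p.1 p.2.1 p.2.2) P)
    (a : Fin N × Fin M) {c : ℝ} (hc : ∀ t, ∫ ω, X t a.1 a.2 ω ∂P = c) (r v : ℝ) (k u : ℕ) :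
    P {ω | (aexpSelect D tb ε δ (fun t i j => X t i j ω) k).y a = u ∧
      v ≤ r * ((aexpSelect D tb ε δ (fun t i j => X t i j ω) k).total a - u * c)} ≤
      ENNReal.ofReal (Real.exp (r ^ 2 / 8 * u - v)) := by
  have hint := lintegral_exp_run_le_one D tb ε δ hX hX01 hindep a hc r k
  have hst : MeasurableState fun ω => aexpSelect D tb ε δ (fun t i j => X t i j ω) k :=
    measurableState_run D tb ε δ (fun ω t i j => X t i j ω) k fun l _ i j => hX l i j
  set Z : Ω → ℝ≥0∞ := fun ω => ENNReal.ofReal (Real.exp (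
      r * ((aexpSelect D tb ε δ (fun t i j => X t i j ω) k).total a -
        (aexpSelect D tb ε δ (fun t i j => X t i j ω) k).y a * c) -
      r ^ 2 / 8 * (aexpSelect D tb ε δ (fun t i j => X t i j ω) k).y a))
  have hZ : Measurable Z := hst.exp a r c
  have hmk := (mul_meas_ge_le_lintegral₀ (μ := P) hZ.aemeasurable
    (ENNReal.ofReal (Real.exp (v - r ^ 2 / 8 * u)))).trans hint
  have hpos : 0 < Real.exp (v - r ^ 2 / 8 * u) := Real.exp_pos _
  have e : ENNReal.ofReal (Real.exp (r ^ 2 / 8 * u - v)) =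
      (ENNReal.ofReal (Real.exp (v - r ^ 2 / 8 * u)))⁻¹ := by
    rw [← ENNReal.ofReal_inv_of_pos hpos, ← Real.exp_neg, neg_sub]
  rw [e, ENNReal.le_inv_iff_mul_le, mul_comm]
  refine le_trans ?_ hmk
  gcongr
  rintro ⟨hu, hv⟩
  refine ENNReal.ofReal_le_ofReal (Real.exp_le_exp.2 ?_)
  rw [hu]
  linarith

/-- The count is random, so a union bound runs over its values `1, ..., k`. Each costs `exp
(-logTerm) = 4δ / (5MN k⁴)`, and the `k` terms leave `k⁻³`. -/
lemma measure_deviates_le (hM : 1 ≤ M) (hN : 2 ≤ N) (hδ : 0 < δ) (hδ' : δ < 1)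
    (hX : ∀ t i j, Measurable (X t i j))
    (hX01 : ∀ t i j, ∀ᵐ ω ∂P, X t i j ω ∈ Set.Icc (0 : ℝ) 1)
    (hindep : iIndepFun (fun p : ℕ × Fin N × Fin M => X p.1 p.2.1 p.2.2) P)
    (a : Fin N × Fin M) {c : ℝ} (hc : ∀ t, ∫ ω, X t a.1 a.2 ω ∂P = c) {σ : ℝ} (hσ : σ ^ 2 = 1)
    (k : ℕ) :
    P {ω | Deviates δ σ c (aexpSelect D tb ε δ (fun t i j => X t i j ω) k) k a} ≤
      ENNReal.ofReal (4 / 5 * (δ / (M * N)) * (1 / (k : ℝ) ^ 3)) := by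
  rcases Nat.eq_zero_or_pos k with rfl | hk
  · have : {ω | Deviates δ σ c (aexpSelect D tb ε δ (fun t i j => X t i j ω) 0) 0 a} = ∅ := by
      ext ω; simp [Deviates, aexpSelect, State.init]
    rw [this]; simp
  have hM' : (0 : ℝ) < M := by exact_mod_cast hM
  have hN' : (0 : ℝ) < N := by exact_mod_cast (by omega : 0 < N)
  have hk' : (0 : ℝ) < k := by exact_mod_cast hk
  -- For radius `ρ`, the slope `r = 4σρ` minimizes `r²u/8 - |r|ρu`, with minimum `-2uρ² = -logTerm`.
  set E : ℕ → Set Ω := fun u =>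
    {ω | (aexpSelect D tb ε δ (fun t i j => X t i j ω) k).y a = u ∧
      4 * u * radius M N δ u k ^ 2 ≤ 4 * σ * radius M N δ u k *
        ((aexpSelect D tb ε δ (fun t i j => X t i j ω) k).total a - u * c)}
  have hsub : {ω | Deviates δ σ c (aexpSelect D tb ε δ (fun t i j => X t i j ω) k) k a} ⊆
      ⋃ u ∈ Finset.Icc 1 k, E u := by
    rintro ω ⟨hy, hd⟩
    have hyk := run_y_le D tb ε δ (fun t i j => X t i j ω) k a
    set s := aexpSelect D tb ε δ (fun t i j => X t i j ω) k
    refine Set.mem_iUnion₂.2 ⟨s.y a, Finset.mem_Icc.2 ⟨by omega, hyk⟩, rfl, ?_⟩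
    have hy' : (0 : ℝ) < s.y a := by exact_mod_cast Nat.pos_of_ne_zero hy
    have hr := radius_nonneg M N δ (s.y a) k
    change _ ≤ 4 * σ * radius M N δ (s.y a) k * (s.total a - s.y a * c)
    have e : s.total a - s.y a * c = s.y a * (s.est a - c) := by
      rw [State.est]; field_simp
    rw [e]
    have := mul_le_mul_of_nonneg_left hd.le (by positivity : 0 ≤ 4 * s.y a * radius M N δ (s.y a) k)
    linarith
  have hE : ∀ u ∈ Finset.Icc 1 k, P (E u) ≤ ENNReal.ofReal (4 / 5 * (δ / (M * N)) / (k : ℝ) ^ 4) := by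
    intro u hu
    have hu0 : u ≠ 0 := by have := (Finset.mem_Icc.1 hu).1; omega
    refine (measure_tail_le D tb ε δ hX hX01 hindep a hc (4 * σ * radius M N δ u k)
      (4 * u * radius M N δ u k ^ 2) k u).trans (ENNReal.ofReal_le_ofReal (le_of_eq ?_))
    have h2 := two_mul_radius_sq hM hN hδ hδ' hu0 hk
    have e : (4 * σ * radius M N δ u k) ^ 2 / 8 * u - 4 * u * radius M N δ u k ^ 2 =
        -logTerm M N δ k := by
      rw [← h2, mul_pow, mul_pow, hσ]; ring
    rw [e, logTerm, Real.exp_neg, Real.exp_log (by positivity)]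
    field_simp
  calc _ ≤ P (⋃ u ∈ Finset.Icc 1 k, E u) := measure_mono hsub
    _ ≤ ∑ u ∈ Finset.Icc 1 k, P (E u) := measure_biUnion_finset_le _ _
    _ ≤ ∑ u ∈ Finset.Icc 1 k, ENNReal.ofReal (4 / 5 * (δ / (M * N)) / (k : ℝ) ^ 4) :=
        Finset.sum_le_sum hE
    _ = ENNReal.ofReal (4 / 5 * (δ / (M * N)) * (1 / (k : ℝ) ^ 3)) := by
        rw [Finset.sum_const, Nat.card_Icc, nsmul_eq_mul, ← ENNReal.ofReal_natCast,
          ← ENNReal.ofReal_mul (by positivity)]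
        congr 1
        push_cast
        field_simp

/-- For `k ≥ 2`, `1/k³` is below `1/((k-1)k(k+1))`, which telescopes to total `1/4`. The term `k =
0` is zero by the division convention, and `k = 1` contributes `1`. -/
lemma sum_range_one_div_cube_le (n : ℕ) : ∑ k ∈ Finset.range n, 1 / (k : ℝ) ^ 3 ≤ (5 / 4 : ℝ) := by
  have h : ∀ n : ℕ, ∑ k ∈ Finset.range (n + 2), 1 / (k : ℝ) ^ 3 ≤
      (5 / 4 : ℝ) - 1 / (2 * ((n : ℝ) + 1) * (n + 2)) := by
    intro n
    induction n with
    | zero => norm_num [Finset.sum_range_succ]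
    | succ n ih =>
      rw [Finset.sum_range_succ]
      have h1 : 1 / ((n + 2 : ℕ) : ℝ) ^ 3 ≤
          1 / (2 * ((n : ℝ) + 1) * (n + 2)) - 1 / (2 * ((n : ℝ) + 2) * (n + 3)) := by
        have e : 1 / (2 * ((n : ℝ) + 1) * (n + 2)) - 1 / (2 * ((n : ℝ) + 2) * (n + 3)) =
            1 / (((n : ℝ) + 1) * (n + 2) * (n + 3)) := by field_simp; ring
        rw [e]
        push_cast
        apply one_div_le_one_div_of_le (by positivity)
        have : (0 : ℝ) ≤ n := n.cast_nonneg
        nlinarith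
      push_cast at h1 ih ⊢
      have e : (2 * ((n : ℝ) + 1 + 1) * (n + 1 + 2)) = 2 * (n + 2) * (n + 3) := by ring
      rw [e]
      linarith
  calc _ ≤ ∑ k ∈ Finset.range (n + 2), 1 / (k : ℝ) ^ 3 :=
        Finset.sum_le_sum_of_subset_of_nonneg (Finset.range_mono (by omega))
          fun _ _ _ => by positivity
    _ ≤ _ := (h n).trans (sub_le_self _ (by positivity))

/-- The factor `5/4` in the radius cancels the bound on the sum of inverse cubes. -/
lemma tsum_measure_deviates_le (hM : 1 ≤ M) (hN : 2 ≤ N) (hδ : 0 < δ) (hδ' : δ < 1)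
    (hX : ∀ t i j, Measurable (X t i j))
    (hX01 : ∀ t i j, ∀ᵐ ω ∂P, X t i j ω ∈ Set.Icc (0 : ℝ) 1)
    (hindep : iIndepFun (fun p : ℕ × Fin N × Fin M => X p.1 p.2.1 p.2.2) P)
    (a : Fin N × Fin M) {c : ℝ} (hc : ∀ t, ∫ ω, X t a.1 a.2 ω ∂P = c) {σ : ℝ}
    (hσ : σ ^ 2 = 1) :
    ∑' k, P {ω | Deviates δ σ c (aexpSelect D tb ε δ (fun t i j => X t i j ω) k) k a} ≤
      ENNReal.ofReal (δ / (M * N)) := by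
  refine (ENNReal.tsum_le_tsum fun k =>
    measure_deviates_le D tb ε δ hM hN hδ hδ' hX hX01 hindep a hc hσ k).trans ?_
  refine ENNReal.tsum_le_of_sum_range_le fun n => ?_
  rw [← ENNReal.ofReal_sum_of_nonneg fun _ _ => by positivity, ← Finset.mul_sum]
  apply ENNReal.ofReal_le_ofReal
  calc _ ≤ 4 / 5 * (δ / (M * N)) * (5 / 4) := by
        gcongr; exact sum_range_one_div_cube_le n
    _ = _ := by ring

lemma sum_ofReal_div_card (hM : 1 ≤ M) (hN : 2 ≤ N) (hδ : 0 < δ) :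
    ∑ _a : Fin N × Fin M, ENNReal.ofReal (δ / (M * N)) = ENNReal.ofReal δ := by
  have hM' : (0 : ℝ) < M := by exact_mod_cast hM
  have hN' : (0 : ℝ) < N := by exact_mod_cast (by omega : 0 < N)
  rw [Finset.sum_const, Finset.card_univ, Fintype.card_prod, Fintype.card_fin, Fintype.card_fin,
    nsmul_eq_mul, ← ENNReal.ofReal_natCast, ← ENNReal.ofReal_mul (by positivity)]
  congr 1
  push_cast
  field_simp

end Deviation

/-! ### Lower bound on the hardness. -/

section Hardness

variable {μ : Fin N → Fin M → ℝ} {ε : ℝ}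

lemma gap_le_one (hN : 2 ≤ N) (hμ : ∀ i j, μ i j ∈ Set.Icc (0 : ℝ) 1) (i : Fin N) (j : Fin M) :
    gap μ i j ≤ 1 := by
  have : NeZero N := ⟨by omega⟩
  have : Nontrivial (Fin N) := Fin.nontrivial_iff_two_le.2 hN
  rw [gap]
  split_ifs
  · obtain ⟨i', hi'⟩ := exists_ne i
    have := le_ciSup (f := fun i' : {i' : Fin N // i' ≠ i} => μ i' j)
      (Set.finite_range _).bddAbove ⟨i', hi'⟩
    dsimp only at this
    linarith [(hμ i j).2, (hμ i' j).1]
  · have : (⨆ i', μ i' j) ≤ 1 := ciSup_le fun i' => (hμ i' j).2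
    linarith [(hμ i j).1]

/-- This is where `ε ≤ 2` matters: every truncated gap is at most `1`, so each summand of `H` is at
least `1`. It lets `H` absorb `MN`, also inside the logarithm. -/
lemma card_le_hardness (hN : 2 ≤ N) (hε : 0 < ε) (hε2 : ε ≤ 2)
    (hμ : ∀ i j, μ i j ∈ Set.Icc (0 : ℝ) 1) : (M * N : ℝ) ≤ hardness μ ε := by
  have h : ∀ j i, 1 ≤ 1 / (max (gap μ i j) (ε / 2)) ^ 2 := by
    intro j i
    have h0 : 0 < max (gap μ i j) (ε / 2) := lt_max_of_lt_right (by positivity)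
    have h1 : max (gap μ i j) (ε / 2) ≤ 1 := max_le (gap_le_one hN hμ i j) (by linarith)
    rw [le_div_iff₀ (by positivity), one_mul]
    exact pow_le_one₀ h0.le h1
  calc (M * N : ℝ) = ∑ _j : Fin M, ∑ _i : Fin N, (1 : ℝ) := by simp
    _ ≤ _ := Finset.sum_le_sum fun j _ => Finset.sum_le_sum fun i _ => h j i

end Hardness

/-! ### Pathwise bound on the number of tests. -/

section Pathwise

variable {G : SimpleGraph (Fin N × Fin M)} (D : DominatingScheme G) (tb : TieBreaking M N)
  (ε δ : ℝ) (x : ℕ → Fin N → Fin M → ℝ)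

/-- Some confidence interval of step `k` fails. -/
def SomeDeviates (δ : ℝ) (μ : Fin N → Fin M → ℝ) (s : State M N) (k : ℕ) : Prop :=
  ∃ a : Fin N × Fin M, Deviates δ 1 (μ a.1 a.2) s k a ∨ Deviates δ (-1) (μ a.1 a.2) s k a

open Classical in
/-- The number of tests is controlled by the number of steps at which a confidence interval
fails. -/
lemma run_length_le (hM : 1 ≤ M) (hN : 2 ≤ N) (hε : 0 < ε) (hδ : 0 < δ) (hδ' : δ < 1)
    (μ : Fin N → Fin M → ℝ) {n : ℕ} (hn : 1 ≤ n)
    (hR : ∀ k < n, (aexpSelect D tb ε δ x k).R ≠ ∅) :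
    (n : ℝ) ≤ ((Finset.range n).filter fun k =>
        SomeDeviates δ μ (aexpSelect D tb ε δ x k) k).card +
      (8 * logTerm M N δ n * hardness μ ε + M * N) := by
  have : NeZero N := ⟨by omega⟩
  have hL := logTerm_nonneg hM hN hδ hδ' hn
  set bad := fun k => SomeDeviates δ μ (aexpSelect D tb ε δ x k) k
  set V : Fin N × Fin M → ℝ := fun a =>
    8 * logTerm M N δ n * (1 / (max (gap μ a.1 a.2) (ε / 2)) ^ 2) with hV
  have hpos : ∀ a : Fin N × Fin M, 0 < max (gap μ a.1 a.2) (ε / 2) := fun a =>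
    lt_max_of_lt_right (by positivity)
  have hcount := card_le_sum_of_y_le D tb ε δ x ((Finset.range n).filter fun k => ¬ bad k)
    (fun k hk => hR k (Finset.mem_range.1 (Finset.mem_filter.1 hk).1)) V
    (fun a => by have := hpos a; positivity) (by
      intro k hk
      obtain ⟨hk, hb⟩ := Finset.mem_filter.1 hk
      have hkn := Finset.mem_range.1 hk
      have hne := hR k hkn
      have hne' := Finset.nonempty_iff_ne_empty.2 hne
      set s := aexpSelect D tb ε δ x k
      set p := s.pickedAction tb δ
      have hp := hpos p
      by_cases hy : s.y p = 0
      · rw [hy]; push_cast; positivity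
      have hk1 : 1 ≤ k := (Nat.one_le_iff_ne_zero.2 hy).trans (run_y_le D tb ε δ x k _)
      have ht : s.t = k := run_t D tb ε δ x hne
      have ho := run_openUncertain D tb ε δ x k
      have h1 := State.half_lt_radius hne' ho hy
      have h2 := State.gap_le_radius hN hε hne' ho hy (μ := μ) (fun a ha => by
        rw [ht]
        by_contra hcon
        rw [not_le, lt_abs] at hcon
        refine hb ⟨a, ?_⟩
        rcases hcon with h | h
        · exact Or.inl ⟨ha, by linarith⟩
        · exact Or.inr ⟨ha, by linarith⟩)
      rw [ht] at h1 h2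
      change ε / 2 < radius M N δ (s.y p) k at h1
      change gap μ p.1 p.2 ≤ 4 * radius M N δ (s.y p) k at h2
      have h3 := two_mul_radius_sq hM hN hδ hδ' hy hk1
      have h4 := logTerm_mono hM hN hδ hδ' hk1 hkn.le
      set ρ := radius M N δ (s.y p) k
      -- One multiple of `ρ` covers both regimes; `16yρ² = 8 (2yρ²)` is the source of the factor
      -- `8`.
      have h5 : max (gap μ p.1 p.2) (ε / 2) ≤ 4 * ρ := max_le h2 (by linarith)
      have h6 : (max (gap μ p.1 p.2) (ε / 2)) ^ 2 ≤ (4 * ρ) ^ 2 := by gcongr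
      rw [hV]
      dsimp only
      rw [mul_one_div, le_div_iff₀ (by positivity)]
      calc (s.y p : ℝ) * (max (gap μ p.1 p.2) (ε / 2)) ^ 2 ≤ s.y p * (4 * ρ) ^ 2 := by gcongr
        _ = 8 * (2 * s.y p * ρ ^ 2) := by ring
        _ ≤ 8 * logTerm M N δ n := by rw [h3]; gcongr)
  have hsum : ∑ a, (V a + 1) = 8 * logTerm M N δ n * hardness μ ε + M * N := by
    rw [Finset.sum_add_distrib, hV, ← Finset.mul_sum, Fintype.sum_prod_type_right]
    simp [hardness, mul_comm]
  have hcard := Finset.card_filter_add_card_filter_not (s := Finset.range n) bad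
  rw [Finset.card_range] at hcard
  have hcard' : (n : ℝ) = ((Finset.range n).filter bad).card +
      ((Finset.range n).filter fun k => ¬ bad k).card := by exact_mod_cast hcard.symm
  rw [← hsum]
  linarith

open Classical in
/-- The previous bound with the logarithm of the number of tests resolved. -/
lemma run_length_le_hardness_mul_log (hM : 1 ≤ M) (hN : 2 ≤ N) (hε : 0 < ε) (hε2 : ε ≤ 2) (hδ : 0 < δ)
    (hδ' : δ < 1) {μ : Fin N → Fin M → ℝ} (hμ : ∀ i j, μ i j ∈ Set.Icc (0 : ℝ) 1) {n : ℕ}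
    (hn : 1 ≤ n) (hR : ∀ k < n, (aexpSelect D tb ε δ x k).R ≠ ∅) :
    (n : ℝ) ≤ 484 * (hardness μ ε * Real.log (hardness μ ε / δ)) +
      2 * ((Finset.range n).filter fun k =>
        SomeDeviates δ μ (aexpSelect D tb ε δ x k) k).card := by
  have h := run_length_le D tb ε δ x hM hN hε hδ hδ' μ hn hR
  set b := ((Finset.range n).filter fun k =>
        SomeDeviates δ μ (aexpSelect D tb ε δ x k) k).card
  set B := (b : ℝ)
  have hMN := card_le_hardness hN hε hε2 hμ
  set H := hardness μ ε
  have hM' : (1 : ℝ) ≤ M := by exact_mod_cast hM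
  have hN' : (2 : ℝ) ≤ N := by exact_mod_cast hN
  have hMN2 : (2 : ℝ) ≤ M * N := by nlinarith
  have hH : 2 ≤ H := hMN2.trans hMN
  have hHδ : H ≤ H / δ := by
    rw [le_div_iff₀ hδ]; nlinarith
  set L := Real.log (H / δ)
  have hlog2 := Real.log_two_gt_d9
  have hL2 : Real.log 2 ≤ L := Real.log_le_log (by norm_num) (hH.trans hHδ)
  have hLH : Real.log H ≤ L := Real.log_le_log (by linarith) hHδ
  have h54 : Real.log (5 / 4) ≤ Real.log 2 := Real.log_le_log (by norm_num) (by norm_num)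
  have hc : Real.log (5 / 4 * (M * N / δ)) ≤ 2 * L := by
    have : Real.log (M * N / δ) ≤ L :=
      Real.log_le_log (by positivity) (by gcongr)
    rw [Real.log_mul (by norm_num) (by positivity)]
    linarith
  have h64 : Real.log (2 * (32 * H)) ≤ 7 * L := by
    rw [show 2 * (32 * H) = 2 ^ 6 * H by ring, Real.log_mul (by norm_num) (by positivity),
      Real.log_pow]
    push_cast
    linarith
  rw [logTerm_eq hM hN hδ hn] at h
  have hn' : (0 : ℝ) < n := by exact_mod_cast hn
  -- The fourth power of `t` in the radius makes the coefficient of `log n` equal to `4 · 8H = 32H`.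
  have hres := le_of_le_add_mul_log (T := n) (A := B + M * N +
    8 * H * Real.log (5 / 4 * (M * N / δ))) (K := 32 * H) hn' (by positivity) (by linarith)
  have e1 : 8 * H * Real.log (5 / 4 * (M * N / δ)) ≤ 8 * H * (2 * L) := by gcongr
  have e2 : 2 * (32 * H) * Real.log (2 * (32 * H)) ≤ 2 * (32 * H) * (7 * L) := by gcongr
  have e3 : (M * N : ℝ) ≤ 2 * (H * L) := by nlinarith
  -- With `L = log (H/δ)`, the terms are `2MN ≤ 4HL`, `16H · 2L = 32HL` and `64H · 7L = 448HL`,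
  -- adding up to `484HL`.
  linarith

end Pathwise

/-! ### The PAC guarantee and the expected cost. -/

section Main

variable {G : SimpleGraph (Fin N × Fin M)} (D : DominatingScheme G) (tb : TieBreaking M N)
  (ε δ : ℝ) {Ω : Type*} [MeasurableSpace Ω] {P : Measure Ω} [IsProbabilityMeasure P]
  {X : ℕ → Fin N → Fin M → Ω → ℝ}

/-- One side per action suffices: a designated best worker must not be underestimated, the others
must not be overestimated. The sign `σ` selects that side, which keeps the total at `δ` rather than
`2δ`. -/
lemma ofReal_one_sub_le_measure (hM : 1 ≤ M) (hN : 2 ≤ N) (hε : 0 < ε) (hδ : 0 < δ) (hδ' : δ < 1)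
    (hX : ∀ t i j, Measurable (X t i j))
    (hX01 : ∀ t i j, ∀ᵐ ω ∂P, X t i j ω ∈ Set.Icc (0 : ℝ) 1)
    (hindep : iIndepFun (fun p : ℕ × Fin N × Fin M => X p.1 p.2.1 p.2.2) P)
    {μ : Fin N → Fin M → ℝ} (hμ : ∀ t i j, ∫ ω, X t i j ω ∂P = μ i j) :
    ENNReal.ofReal (1 - δ) ≤ P {ω | ∃ S : Finset (Fin N),
      IsOutput D tb ε δ (fun t i j => X t i j ω) S ∧ S.card ≤ M ∧ IsEpsOptimalTeam μ ε S} := by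
  have : NeZero N := ⟨by omega⟩
  have hbest : ∀ j, ∃ b, ∀ i, μ i j ≤ μ b j := fun j => Finite.exists_max fun i => μ i j
  choose b hb using hbest
  set σ : Fin N × Fin M → ℝ := fun a => if a.1 = b a.2 then -1 else 1 with hσ
  have hσ2 : ∀ a, σ a ^ 2 = 1 := fun a => by rw [hσ]; dsimp only; split_ifs <;> norm_num
  set bad : Set Ω := ⋃ a, ⋃ k, {ω | Deviates δ (σ a) (μ a.1 a.2)
    (aexpSelect D tb ε δ (fun t i j => X t i j ω) k) k a}
  have hbad : P bad ≤ ENNReal.ofReal δ := by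
    rw [← sum_ofReal_div_card δ hM hN hδ]
    calc P bad ≤ ∑ a, P (⋃ k, {ω | Deviates δ (σ a) (μ a.1 a.2)
          (aexpSelect D tb ε δ (fun t i j => X t i j ω) k) k a}) := measure_iUnion_fintype_le _ _
      _ ≤ _ := Finset.sum_le_sum fun a _ => (measure_iUnion_le _).trans
          (tsum_measure_deviates_le D tb ε δ hM hN hδ hδ' hX hX01 hindep a
            (fun t => hμ t a.1 a.2) (hσ2 a))
  have hsub : badᶜ ⊆ {ω | ∃ S : Finset (Fin N),
      IsOutput D tb ε δ (fun t i j => X t i j ω) S ∧ S.card ≤ M ∧ IsEpsOptimalTeam μ ε S} := by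
    intro ω hω
    simp only [bad, Set.mem_compl_iff, Set.mem_iUnion, not_exists] at hω
    have hω' : ∀ a k, (aexpSelect D tb ε δ (fun t i j => X t i j ω) k).y a ≠ 0 →
        σ a * ((aexpSelect D tb ε δ (fun t i j => X t i j ω) k).est a - μ a.1 a.2) ≤
          radius M N δ ((aexpSelect D tb ε δ (fun t i j => X t i j ω) k).y a) k := by
      intro a k hy
      by_contra hcon
      exact hω a k ⟨hy, not_le.1 hcon⟩
    obtain ⟨k, hk⟩ := exists_run_eq_empty D tb ε δ (fun t i j => X t i j ω) hM hN hε hδ hδ'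
    refine ⟨_, ⟨k, hk, rfl⟩, ?_, ?_⟩
    · exact (Nat.le_add_right _ _).trans (run_card D tb ε δ (fun t i j => X t i j ω) k)
    · intro j
      refine run_eps_optimal D tb ε δ (fun t i j => X t i j ω) hN hε b (fun i j => hb j i) ?_ ?_ k j
        (by simp [hk])
      · intro k j hy
        have := hω' (b j, j) k hy
        simp only [hσ, if_true] at this
        linarith
      · intro k i j hi hy
        have := hω' (i, j) k hy
        simp only [hσ, if_neg hi] at this
        linarith
  -- Subadditivity is enough here, so `bad` need not be shown measurable.
  have h1 : 1 ≤ P bad + P badᶜ := by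
    rw [← measure_univ (μ := P), ← Set.union_compl_self bad]
    exact measure_union_le _ _
  rw [ENNReal.ofReal_sub _ hδ.le, ENNReal.ofReal_one, tsub_le_iff_left]
  exact h1.trans (add_le_add hbad (measure_mono hsub))

open Classical in
-- Extending the failure count to all steps removes the random horizon, so its expectation becomes a
-- sum of probabilities.
lemma numTests_le (hM : 1 ≤ M) (hN : 2 ≤ N) (hε : 0 < ε) (hε2 : ε ≤ 2) (hδ : 0 < δ) (hδ' : δ < 1)
    {μ : Fin N → Fin M → ℝ} (hμ : ∀ i j, μ i j ∈ Set.Icc (0 : ℝ) 1)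
    (x : ℕ → Fin N → Fin M → ℝ) :
    (numTests D tb ε δ x : ℝ≥0∞) ≤
      ENNReal.ofReal (484 * (hardness μ ε * Real.log (hardness μ ε / δ))) +
        2 * ∑' k, if SomeDeviates δ μ (aexpSelect D tb ε δ x k) k then (1 : ℝ≥0∞) else 0 := by
  have hex := exists_run_eq_empty D tb ε δ x hM hN hε hδ hδ'
  set n := Nat.find hex
  have hle : numTests D tb ε δ x ≤ (n : ℕ∞) := iInf₂_le n (Nat.find_spec hex)
  have hle' : (numTests D tb ε δ x : ℝ≥0∞) ≤ (n : ℝ≥0∞) := by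
    have := ENat.toENNReal_le.2 hle
    simpa using this
  refine hle'.trans ?_
  rcases Nat.eq_zero_or_pos n with hn | hn
  · rw [hn]; simp
  have h := run_length_le_hardness_mul_log D tb ε δ x hM hN hε hε2 hδ hδ' hμ hn fun k hk => Nat.find_min hex hk
  set B := ((Finset.range n).filter fun k => SomeDeviates δ μ (aexpSelect D tb ε δ x k) k).card
  have hB : (B : ℝ≥0∞) ≤
      ∑' k, if SomeDeviates δ μ (aexpSelect D tb ε δ x k) k then (1 : ℝ≥0∞) else 0 := by
    refine le_trans (le_of_eq ?_) (ENNReal.sum_le_tsum (Finset.range n))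
    rw [Finset.sum_boole]
  calc (n : ℝ≥0∞) = ENNReal.ofReal n := (ENNReal.ofReal_natCast n).symm
    _ ≤ ENNReal.ofReal (484 * (hardness μ ε * Real.log (hardness μ ε / δ)) + 2 * B) :=
        ENNReal.ofReal_le_ofReal h
    _ ≤ ENNReal.ofReal (484 * (hardness μ ε * Real.log (hardness μ ε / δ))) +
        ENNReal.ofReal (2 * B) := ENNReal.ofReal_add_le
    _ = ENNReal.ofReal (484 * (hardness μ ε * Real.log (hardness μ ε / δ))) + 2 * B := by
        rw [ENNReal.ofReal_mul (p := 2) (by norm_num), ENNReal.ofReal_natCast]; simp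
    _ ≤ _ := by gcongr

lemma tsum_measure_someDeviates_le (hM : 1 ≤ M) (hN : 2 ≤ N) (hδ : 0 < δ)
    (hδ' : δ < 1) (hX : ∀ t i j, Measurable (X t i j))
    (hX01 : ∀ t i j, ∀ᵐ ω ∂P, X t i j ω ∈ Set.Icc (0 : ℝ) 1)
    (hindep : iIndepFun (fun p : ℕ × Fin N × Fin M => X p.1 p.2.1 p.2.2) P)
    {μ : Fin N → Fin M → ℝ} (hμ : ∀ t i j, ∫ ω, X t i j ω ∂P = μ i j) :
    ∑' k, P {ω | SomeDeviates δ μ (aexpSelect D tb ε δ (fun t i j => X t i j ω) k) k} ≤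
      2 * ENNReal.ofReal δ := by
  set dev : ℝ → ℕ → Fin N × Fin M → Set Ω := fun σ k a =>
    {ω | Deviates δ σ (μ a.1 a.2) (aexpSelect D tb ε δ (fun t i j => X t i j ω) k) k a}
  have hle : ∀ k, P {ω | SomeDeviates δ μ (aexpSelect D tb ε δ (fun t i j => X t i j ω) k) k} ≤
      ∑ a, (P (dev 1 k a) + P (dev (-1) k a)) := by
    intro k
    have : {ω | SomeDeviates δ μ (aexpSelect D tb ε δ (fun t i j => X t i j ω) k) k} =
        ⋃ a, (dev 1 k a ∪ dev (-1) k a) := by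
      ext ω; simp [SomeDeviates, dev]
    rw [this]
    exact (measure_iUnion_fintype_le _ _).trans
      (Finset.sum_le_sum fun a _ => measure_union_le _ _)
  have hdev : ∀ σ : ℝ, σ ^ 2 = 1 → ∀ a, ∑' k, P (dev σ k a) ≤ ENNReal.ofReal (δ / (M * N)) :=
    fun σ hσ a => tsum_measure_deviates_le D tb ε δ hM hN hδ hδ' hX hX01 hindep a
      (fun t => hμ t a.1 a.2) hσ
  calc _ ≤ ∑' k, ∑ a, (P (dev 1 k a) + P (dev (-1) k a)) := ENNReal.tsum_le_tsum hle
    _ = ∑ a, (∑' k, P (dev 1 k a) + ∑' k, P (dev (-1) k a)) := by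
        rw [Summable.tsum_finsetSum fun _ _ => ENNReal.summable]
        exact Finset.sum_congr rfl fun a _ => ENNReal.tsum_add
    _ ≤ ∑ a : Fin N × Fin M, (ENNReal.ofReal (δ / (M * N)) + ENNReal.ofReal (δ / (M * N))) :=
        Finset.sum_le_sum fun a _ =>
          add_le_add (hdev 1 (by norm_num) a) (hdev (-1) (by norm_num) a)
    _ = 2 * ENNReal.ofReal δ := by
        rw [Finset.sum_add_distrib, sum_ofReal_div_card δ hM hN hδ, two_mul]

/-- The pathwise bound holds on every outcome and is integrated directly; failing steps cost only `2
· 2δ` in expectation. -/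
lemma lintegral_numTests_le (hM : 1 ≤ M) (hN : 2 ≤ N) (hε : 0 < ε) (hε2 : ε ≤ 2) (hδ : 0 < δ)
    (hδ' : δ < 1) (hX : ∀ t i j, Measurable (X t i j))
    (hX01 : ∀ t i j, ∀ᵐ ω ∂P, X t i j ω ∈ Set.Icc (0 : ℝ) 1)
    (hindep : iIndepFun (fun p : ℕ × Fin N × Fin M => X p.1 p.2.1 p.2.2) P)
    {μ : Fin N → Fin M → ℝ} (hμ : ∀ t i j, ∫ ω, X t i j ω ∂P = μ i j)
    (hμ01 : ∀ i j, μ i j ∈ Set.Icc (0 : ℝ) 1) :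
    ∫⁻ ω, (numTests D tb ε δ (fun t i j => X t i j ω) : ℝ≥0∞) ∂P ≤
      ENNReal.ofReal (500 * (hardness μ ε * Real.log (hardness μ ε / δ))) := by
  classical
  have hmeas : ∀ k, MeasurableSet
      {ω | SomeDeviates δ μ (aexpSelect D tb ε δ (fun t i j => X t i j ω) k) k} := by
    intro k
    have hst : MeasurableState fun ω => aexpSelect D tb ε δ (fun t i j => X t i j ω) k :=
      measurableState_run D tb ε δ (fun ω t i j => X t i j ω) k fun l _ i j => hX l i j
    have : {ω | SomeDeviates δ μ (aexpSelect D tb ε δ (fun t i j => X t i j ω) k) k} =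
        ⋃ a : Fin N × Fin M,
          ({ω | Deviates δ 1 (μ a.1 a.2) (aexpSelect D tb ε δ (fun t i j => X t i j ω) k) k a} ∪
          {ω | Deviates δ (-1) (μ a.1 a.2)
            (aexpSelect D tb ε δ (fun t i j => X t i j ω) k) k a}) := by
      ext ω; simp [SomeDeviates]
    rw [this]
    exact MeasurableSet.iUnion fun a =>
      (measurableSet_deviates δ hst 1 _ a).union (measurableSet_deviates δ hst (-1) _ a)
  set I : ℕ → Ω → ℝ≥0∞ := fun k ω =>
    if SomeDeviates δ μ (aexpSelect D tb ε δ (fun t i j => X t i j ω) k) k then 1 else 0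
  have hI : ∀ k, Measurable (I k) := fun k =>
    Measurable.ite (hmeas k) measurable_const measurable_const
  have hIint : ∀ k, ∫⁻ ω, I k ω ∂P =
      P {ω | SomeDeviates δ μ (aexpSelect D tb ε δ (fun t i j => X t i j ω) k) k} := by
    intro k
    rw [← lintegral_indicator_one (hmeas k)]
    refine lintegral_congr fun ω => ?_
    simp [I, Set.indicator_apply]
  have hMN := card_le_hardness hN hε hε2 hμ01
  have hM' : (1 : ℝ) ≤ M := by exact_mod_cast hM
  have hN' : (2 : ℝ) ≤ N := by exact_mod_cast hN
  set H := hardness μ ε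
  have hH : 2 ≤ H := by nlinarith
  have hL : Real.log 2 ≤ Real.log (H / δ) := by
    apply Real.log_le_log (by norm_num)
    rw [le_div_iff₀ hδ]; nlinarith
  have hlog2 := Real.log_two_gt_d9
  -- Together with `δ < 1`, this absorbs `4δ` into the slack between `484` and `500`.
  have hHL : 1 ≤ H * Real.log (H / δ) := by nlinarith
  calc _ ≤ ∫⁻ ω, (ENNReal.ofReal (484 * (H * Real.log (H / δ))) + 2 * ∑' k, I k ω) ∂P :=
        lintegral_mono fun ω => numTests_le D tb ε δ hM hN hε hε2 hδ hδ' hμ01 _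
    _ = ENNReal.ofReal (484 * (H * Real.log (H / δ))) + 2 * ∑' k, ∫⁻ ω, I k ω ∂P := by
        rw [lintegral_add_left measurable_const, lintegral_const, measure_univ, mul_one,
          lintegral_const_mul _ (Measurable.tsum hI),
          lintegral_tsum fun k => (hI k).aemeasurable]
    _ ≤ ENNReal.ofReal (484 * (H * Real.log (H / δ))) + 2 * (2 * ENNReal.ofReal δ) := by
        simp only [hIint]
        gcongr
        exact tsum_measure_someDeviates_le D tb ε δ hM hN hδ hδ' hX hX01 hindep hμ
    _ = ENNReal.ofReal (484 * (H * Real.log (H / δ)) + 4 * δ) := by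
        rw [ENNReal.ofReal_add (by positivity) (by positivity), ENNReal.ofReal_mul (p := 4)
          (by norm_num), ← mul_assoc 2 2, show ENNReal.ofReal 4 = 2 * 2 by norm_num]
    _ ≤ _ := ENNReal.ofReal_le_ofReal (by linarith)

end Main

end TeamHiring

theorem theorem2 :
    ∃ C : ℝ, 0 < C ∧
      ∀ (M N : ℕ) (_hM : 1 ≤ M) (_hN : 2 ≤ N)
        -- the side-observation graphs, a dominating set of their product, tie-breaking rules
        (Gw : SimpleGraph (Fin N)) (Go : SimpleGraph (Fin M))
        (D : TeamHiring.DominatingScheme (Gw.boxProd Go)) (tb : TeamHiring.TieBreaking M N)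
        (ε δ : ℝ) (_hε : 0 < ε) (_hδ : 0 < δ) (_hδ' : δ < 1)
        -- performance values: independent, `X t i j` with law `ν i j` supported in `[0, 1]`
        (ν : Fin N → Fin M → Measure ℝ) (_hν : ∀ i j, ν i j (Set.Icc 0 1)ᶜ = 0)
        (Ω : Type*) [MeasurableSpace Ω] (P : Measure Ω) [IsProbabilityMeasure P]
        (X : ℕ → Fin N → Fin M → Ω → ℝ)
        (_hX : ∀ t i j, Measurable (X t i j))
        (_hlaw : ∀ t i j, P.map (X t i j) = ν i j)
        (_hindep : iIndepFun (fun p : ℕ × Fin N × Fin M => X p.1 p.2.1 p.2.2) P)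
        (μ : Fin N → Fin M → ℝ) (_hμ : ∀ i j, μ i j = ∫ x, x ∂(ν i j)),
        -- with probability at least `1 - δ`, an `ε`-optimal team of size at most `M` is output
        ENNReal.ofReal (1 - δ) ≤
            P {ω | ∃ S : Finset (Fin N),
              TeamHiring.IsOutput D tb ε δ (fun t i j => X t i j ω) S ∧
                S.card ≤ M ∧ TeamHiring.IsEpsOptimalTeam μ ε S} ∧
        -- the expected number of tests
        (ε ≤ 2 →
          ∫⁻ ω, (TeamHiring.numTests D tb ε δ (fun t i j => X t i j ω) : ℝ≥0∞) ∂P ≤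
            ENNReal.ofReal
              (C * (TeamHiring.hardness μ ε * Real.log (TeamHiring.hardness μ ε / δ)))) := by

  refine ⟨500, by norm_num, ?_⟩
  intro M N hM hN Gw Go D tb ε δ hε hδ hδ' ν hν Ω _ P _ X hX hlaw hindep μ hμ
  have hX01 : ∀ t i j, ∀ᵐ ω ∂P, X t i j ω ∈ Set.Icc (0 : ℝ) 1 := by
    intro t i j
    have h := hν i j
    rw [← hlaw t i j, Measure.map_apply (hX t i j) measurableSet_Icc.compl] at h
    exact h
  have hmean : ∀ t i j, ∫ ω, X t i j ω ∂P = μ i j := by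
    intro t i j
    rw [hμ, ← hlaw t i j]
    exact (integral_map (hX t i j).aemeasurable aestronglyMeasurable_id).symm
  have hμ01 : ∀ i j, μ i j ∈ Set.Icc (0 : ℝ) 1 := by
    intro i j
    rw [← hmean 0 i j]
    have hint : Integrable (X 0 i j) P :=
      Integrable.of_mem_Icc 0 1 (hX 0 i j).aemeasurable (hX01 0 i j)
    refine ⟨integral_nonneg_of_ae ((hX01 0 i j).mono fun ω h => h.1), ?_⟩
    calc _ ≤ ∫ _, (1 : ℝ) ∂P :=
          integral_mono_ae hint (integrable_const 1) ((hX01 0 i j).mono fun ω h => h.2)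
      _ = 1 := by simp
  exact ⟨TeamHiring.ofReal_one_sub_le_measure D tb ε δ hM hN hε hδ hδ' hX hX01 hindep hmean,
    fun hε2 => TeamHiring.lintegral_numTests_le D tb ε δ hM hN hε hε2 hδ hδ' hX hX01 hindep hmean
      hμ01⟩
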